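/- For $n\ge 1$ let $\mathbb B^n=\{z\in\mathbb C^n:\|z\|<1\}$ (Euclidean norm), and let $\mathrm{Hol}(\mathbb B^n,\mathbb C^n)$ be the space of holomorphic maps $\mathbb B^n\to\mathbb C^n$ with the topology of uniform convergence on compacta. A map in it is univalent if it is injective; it is starlike if it is univalent, fixes $0$, and its image is star-shaped with respect to $0$. A normal Loewner chain is a family $(f_t)_{t\ge0}$ of univalent maps in $\mathrm{Hol}(\mathbb B^n,\mathbb C^n)$ with $f_s(\mathbb B^n)\subset f_t(\mathbb B^n)$ for $0\le s\le t$, $f_t(0)=0$, $d(f_t)_0=e^t\,\mathrm{id}$, such that $\{e^{-t}f_t\}_{t\ge0}$ is a normal family (every sequence in it has a subsequence converging in $\mathrm{Hol}(\mathbb B^n,\mathbb C^n)$). Let $S^0(\mathbb B^n)$ be the set of univalent maps $f$ with $f(0)=0$, $df_0=\mathrm{id}$ for which there is a normal Loewner chain $(f_t)$ with $f_0=f$. A map $f\in S^0(\mathbb B^n)$ is a support point if there is a continuous $\mathbb C$-linear functional $\Lambda:\mathrm{Hol}(\mathbb B^n,\mathbb C^n)\to\mathbb C$, not constant on $S^0(\mathbb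 B^n)$, with $\operatorname{Re}\Lambda(f)=\max_{h\in S^0(\mathbb B^n)}\operatorname{Re}\Lambda(h)$. **Theorem 1.1.** Let $\Phi:\mathbb B^2\to\mathbb C^2$ be the shear $\Phi(z_1,z_2)=\bigl(z_1+\tfrac{3\sqrt3}{2}z_2^2,\;z_2\bigr)$, and for $f=(f_1,f_2)\in\mathrm{Hol}(\mathbb B^2,\mathbb C^2)$ let $L(f)=\tfrac12\,\dfrac{\partial^2 f_1}{\partial z_2^2}(0)$. Then $\Phi$ belongs to $S^0(\mathbb B^2)$, is starlike and bounded, and $$\operatorname{Re}L(\Phi)=\max_{f\in S^0(\mathbb B^2)}\operatorname{Re}L(f).$$ Moreover $L$ is a continuous linear functional on $\mathrm{Hol}(\mathbb B^2,\mathbb C^2)$ that is not constant on $S^0(\mathbb B^2)$; in particular $\Phi$ is a bounded support point of $S^0(\mathbb B^2)$. -/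

import Mathlib

open Filter Topology
open scoped NNReal

namespace Loewner

/-- The complex Euclidean space `ℂⁿ` with its Hermitian norm. -/
abbrev Cn (n : ℕ) : Type := EuclideanSpace ℂ (Fin n)

/-- The open unit ball `𝔹ⁿ` of `ℂⁿ`. -/
abbrev B (n : ℕ) : Set (Cn n) := Metric.ball (0 : Cn n) 1

/-- The origin as a point of the ball. -/
def origin (n : ℕ) : B n := ⟨0, Metric.mem_ball_self one_pos⟩

/-- Extension by `0` of a map on the ball to all of `ℂⁿ`. It is only used to speak of
complex derivatives at points of the (open) ball. -/
noncomputable def extend {n : ℕ} (f : B n → Cn n) : Cn n → Cn n := by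
  classical
  exact fun z => if h : z ∈ B n then f ⟨z, h⟩ else 0

theorem extend_of_mem {n : ℕ} (f : B n → Cn n) {z : Cn n} (h : z ∈ B n) :
    extend f z = f ⟨z, h⟩ := by
  simp only [extend]
  exact dif_pos h

/-- `Hol(𝔹ⁿ, ℂⁿ)`, the space of holomorphic maps from the ball to `ℂⁿ`. Its topology is the one
induced by the compact-open topology of `C(𝔹ⁿ, ℂⁿ)`, i.e. uniform convergence on compacta. -/
def Hol (n : ℕ) : Submodule ℂ C(B n, Cn n) where
  carrier := {f | DifferentiableOn ℂ (extend f) (B n)}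
  add_mem' := by
    intro f g hf hg
    refine (DifferentiableOn.add hf hg).congr fun z hz => ?_
    simp [extend_of_mem _ hz]
  zero_mem' := by
    refine (differentiableOn_const (0 : Cn n)).congr fun z hz => ?_
    simp [extend_of_mem _ hz]
  smul_mem' := by
    intro c f hf
    refine (DifferentiableOn.const_smul hf c).congr fun z hz => ?_
    simp [extend_of_mem _ hz]

/-- The restriction to the ball of an entire map. -/
def restrictBall {n : ℕ} (F : Cn n → Cn n) (hF : Differentiable ℂ F) : Hol n :=
  ⟨⟨fun z => F z, hF.continuous.comp continuous_subtype_val⟩, by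
    refine hF.differentiableOn.congr fun z hz => ?_
    rw [extend_of_mem _ hz]
    rfl⟩

/-- A univalent map: an injective holomorphic map. -/
def IsUnivalent {n : ℕ} (f : Hol n) : Prop := Function.Injective (f : C(B n, Cn n))

/-- `df₀ = c · id`. -/
def HasScalarDerivAtOrigin {n : ℕ} (f : Hol n) (c : ℂ) : Prop :=
  HasFDerivAt (extend (f : C(B n, Cn n))) (c • ContinuousLinearMap.id ℂ (Cn n)) 0

/-- `S(𝔹ⁿ)`: univalent maps with `f(0) = 0` and `df₀ = id`. -/
def classS (n : ℕ) : Set (Hol n) :=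
  {f | IsUnivalent f ∧ (f : C(B n, Cn n)) (origin n) = 0 ∧ HasScalarDerivAtOrigin f 1}

/-- Normalized Loewner chains `(f_t)_{t ≥ 0}` on `𝔹ⁿ`. -/
structure IsNormalizedLoewnerChain {n : ℕ} (f : ℝ≥0 → Hol n) : Prop where
  univalent : ∀ t, IsUnivalent (f t)
  range_subset : ∀ s t, s ≤ t →
    Set.range (f s : C(B n, Cn n)) ⊆ Set.range (f t : C(B n, Cn n))
  map_origin : ∀ t, (f t : C(B n, Cn n)) (origin n) = 0
  deriv_origin : ∀ t, HasScalarDerivAtOrigin (f t) (Real.exp (t : ℝ) : ℂ)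

/-- A family of holomorphic maps is normal if each sequence in it has a subsequence converging
uniformly on compacta. -/
def IsNormalFamily {n : ℕ} (F : Set (Hol n)) : Prop :=
  ∀ u : ℕ → Hol n, (∀ k, u k ∈ F) →
    ∃ (g : Hol n) (φ : ℕ → ℕ), StrictMono φ ∧ Tendsto (fun k => u (φ k)) atTop (𝓝 g)

/-- Normal Loewner chains: normalized Loewner chains with `{e^{-t} f_t}` a normal family. -/
def IsNormalLoewnerChain {n : ℕ} (f : ℝ≥0 → Hol n) : Prop :=
  IsNormalizedLoewnerChain f ∧
    IsNormalFamily (Set.range fun t : ℝ≥0 => (Real.exp (-(t : ℝ)) : ℂ) • f t)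

/-- `S⁰(𝔹ⁿ)`: the maps in `S(𝔹ⁿ)` which admit parametric representation. -/
def classS0 (n : ℕ) : Set (Hol n) :=
  {f | f ∈ classS n ∧ ∃ c : ℝ≥0 → Hol n, IsNormalLoewnerChain c ∧ c 0 = f}

/-- `f` is a support point of `S⁰(𝔹ⁿ)` for the continuous linear functional `L`. -/
def IsSupportPointFor {n : ℕ} (L : Hol n →L[ℂ] ℂ) (f : Hol n) : Prop :=
  f ∈ classS0 n ∧ (∃ g ∈ classS0 n, ∃ h ∈ classS0 n, L g ≠ L h) ∧
    ∀ h ∈ classS0 n, (L h).re ≤ (L f).re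

/-- Support points of `S⁰(𝔹ⁿ)`. -/
def IsSupportPoint {n : ℕ} (f : Hol n) : Prop := ∃ L : Hol n →L[ℂ] ℂ, IsSupportPointFor L f

/-- Starlike maps: univalent maps fixing the origin whose image is starlike with respect to the
origin. -/
def IsStarlike {n : ℕ} (f : Hol n) : Prop :=
  IsUnivalent f ∧ (f : C(B n, Cn n)) (origin n) = 0 ∧
    StarConvex ℝ (0 : Cn n) (Set.range (f : C(B n, Cn n)))

/-- The functional `f ↦ ½ ∂²f₁/∂z₂²(0)` on `Hol(𝔹², ℂ²)` (coordinates are numbered from `0`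
in `Fin 2`). -/
noncomputable def coeffL (f : Hol 2) : ℂ :=
  (1 / 2 : ℂ) *
    iteratedDeriv 2 (fun w : ℂ => extend (f : C(B 2, Cn 2)) !₂[(0 : ℂ), w] 0) 0

/-- The entire shear `(z₁, z₂) ↦ (z₁ + (3√3/2) z₂², z₂)`. -/
noncomputable def shear (z : Cn 2) : Cn 2 :=
  !₂[z 0 + (3 * (Real.sqrt 3 : ℂ) / 2) * z 1 ^ 2, z 1]

theorem differentiable_shear : Differentiable ℂ shear := by
  rw [differentiable_euclidean]
  intro i
  fin_cases i
  · simp only [shear]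
    change Differentiable ℂ fun z : Cn 2 => z 0 + (3 * (Real.sqrt 3 : ℂ) / 2) * z 1 ^ 2
    fun_prop
  · change Differentiable ℂ fun z : Cn 2 => z 1
    fun_prop

/-- The map `Φ`: the shear restricted to the ball. -/
noncomputable def Phi : Hol 2 := restrictBall shear differentiable_shear

end Loewner

/-! Write K = 3√3/2 and let p(t) = e^{-2t} L(c_t) along a normal Loewner chain. The upper bound
compares c_s and c_t, s ≤ t, through the transition map φ = c_t⁻¹ ∘ c_s, a self-map of the ball
fixing 0. Along the disc ζ ↦ (ζ²z₁, ζz₂), whose weights give z₁ and z₂² the same degree, the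
function conj(z₁) ζ⁻² φ₁ + conj(z₂) ζ⁻¹ φ₂ extends over ζ = 0, and its value there contains p(s) -
p(t) multiplied by conj(z₁) z₂². By Cauchy-Schwarz it is at most ‖z‖ on the unit circle, so the
maximum principle bounds the value at 0 (`norm_transition_average_le`). On the unit sphere |z₁||z₂|²
is largest at |z₁|² = 1/3, with maximum 2√3/9 = 1/K; this choice of z gives |p(s) - p(t)| ≤ K
(e^{t-s} - 1) e^{-s} (`norm_quadCoeff_sub_le`). Summing over a partition of mesh h yields |p(0)| ≤
|p(Nh)| + K e^h. Normality makes p tend to 0 along a subsequence, and h → 0 gives |L(c_0)| ≤ K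
(`norm_coeffL_le_of_mem_classS0`). The map Φ attains K. It lies in the class because e^t Φ is a
normal chain as soon as the image is star-shaped, and star-shapedness rests on the same inequality
K|z₁||z₂|² ≤ ‖z‖² (`norm_sq_radial_lt_one`). Holomorphy of the inverse of an injective holomorphic
map is not needed in full: openness (`image_mem_nhds_of_injOn`) and holomorphy off the zero set of
the Jacobian suffice, thanks to maximum principles that tolerate such exceptional sets. -/

namespace Loewner

/-! ### Regularity of holomorphic maps between normed spaces -/

section SeveralVariables

open Metric Set

variable {E F : Type*} [NormedAddCommGroup E] [NormedSpace ℂ E] [NormedAddCommGroup F]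
  [NormedSpace ℂ F]

/-- The derivative of a holomorphic map is continuous. -/
theorem continuousAt_fderiv_of_differentiableOn {f : E → F} {U : Set E} (hU : IsOpen U)
    (hf : DifferentiableOn ℂ f U) {p : E} (hp : p ∈ U) : ContinuousAt (fderiv ℂ f) p := by
  rw [Metric.continuousAt_iff]
  intro ε hε
  have hd : HasFDerivAt f (fderiv ℂ f p) p := (hf.differentiableAt (hU.mem_nhds hp)).hasFDerivAt
  have h1 := hd.isLittleO.def (show (0 : ℝ) < ε / 4 by positivity)
  obtain ⟨r, hr, hball⟩ := Metric.eventually_nhds_iff_ball.1 (h1.and (hU.mem_nhds hp))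
  refine ⟨r / 2, by positivity, fun {z} hz => ?_⟩
  set g : E → F := fun w => f w - fderiv ℂ f p (w - p) with hg
  have hsub : ball z (r / 2) ⊆ ball p r := fun w hw => by
    rw [mem_ball] at hw ⊢
    linarith [dist_triangle w z p]
  have hgd : ∀ w ∈ ball p r, HasFDerivAt g (fderiv ℂ f w - fderiv ℂ f p) w := fun w hw => by
    refine HasFDerivAt.sub (hf.differentiableAt (hU.mem_nhds (hball w hw).2)).hasFDerivAt ?_
    exact (fderiv ℂ f p).hasFDerivAt.comp w ((hasFDerivAt_id w).sub_const p)
  have hgp : ∀ w ∈ ball p r, ‖g w - f p‖ ≤ ε / 4 * r := fun w hw => by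
    have := (hball w hw).1
    calc ‖g w - f p‖ = ‖f w - f p - fderiv ℂ f p (w - p)‖ := by
          simp only [hg]; congr 1; abel
      _ ≤ ε / 4 * ‖w - p‖ := this
      _ ≤ ε / 4 * r := by
          have : ‖w - p‖ < r := by simpa [dist_eq_norm] using hw
          gcongr
  have hz' : z ∈ ball p r := by
    rw [mem_ball]; linarith
  -- Schwarz estimate on a ball of radius r/2 for f minus its linear part at p: the oscillation is
  -- at most 3εr/8, so the derivative is at most 3ε/4 in norm.
  have key := Complex.norm_fderiv_le_div_of_mapsTo_ball (f := g) (c := z) (R₁ := r / 2)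
    (R₂ := ε / 4 * r + ε / 8 * r)
    (fun w hw => (hgd w (hsub hw)).differentiableAt.differentiableWithinAt)
    (fun w hw => by
      have hgz : ‖g z - f p‖ ≤ ε / 8 * r := by
        have := (hball z hz').1
        calc ‖g z - f p‖ = ‖f z - f p - fderiv ℂ f p (z - p)‖ := by
              simp only [hg]; congr 1; abel
          _ ≤ ε / 4 * ‖z - p‖ := this
          _ ≤ ε / 4 * (r / 2) := by
              have : ‖z - p‖ < r / 2 := by simpa [dist_eq_norm] using hz
              gcongr
          _ = ε / 8 * r := by ring
      rw [mem_closedBall, dist_eq_norm]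
      calc ‖g w - g z‖ = ‖(g w - f p) - (g z - f p)‖ := by congr 1; abel
        _ ≤ _ := (norm_sub_le _ _).trans (add_le_add (hgp w (hsub hw)) hgz)) (by positivity)
  rw [(hgd z hz').fderiv] at key
  rw [dist_eq_norm]
  refine key.trans_lt ?_
  rw [div_lt_iff₀ (by positivity)]
  nlinarith

/-- Directional derivatives of a holomorphic map are holomorphic. -/
theorem differentiableOn_fderiv_apply [CompleteSpace F] {f : E → F} {U : Set E} (hU : IsOpen U)
    (hf : DifferentiableOn ℂ f U) (v : E) :
    DifferentiableOn ℂ (fun z => fderiv ℂ f z v) U := by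
  intro p hp
  have hcont := continuousAt_fderiv_of_differentiableOn hU hf hp
  have hbd : ∀ᶠ z in 𝓝 p, ‖fderiv ℂ f z‖ < ‖fderiv ℂ f p‖ + 1 :=
    hcont.norm.eventually (gt_mem_nhds (lt_add_one _))
  obtain ⟨ρ, hρ, hball⟩ := Metric.eventually_nhds_iff_ball.1 (hbd.and (hU.mem_nhds hp))
  obtain ⟨r, hr, hrv⟩ : ∃ r : ℝ, 0 < r ∧ r * ‖v‖ < ρ / 2 := by
    refine ⟨ρ / 2 / (‖v‖ + 1), by positivity, ?_⟩
    rw [div_mul_eq_mul_div, div_lt_iff₀ (by positivity)]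
    nlinarith [norm_nonneg v]
  have hmem : ∀ z ∈ ball p (ρ / 2), ∀ ζ ∈ closedBall (0 : ℂ) r, z + ζ • v ∈ ball p ρ := by
    intro z hz ζ hζ
    rw [mem_ball, dist_eq_norm] at hz ⊢
    rw [mem_closedBall_zero_iff] at hζ
    calc ‖z + ζ • v - p‖ = ‖(z - p) + ζ • v‖ := by congr 1; abel
      _ ≤ ‖z - p‖ + ‖ζ‖ * ‖v‖ := (norm_add_le _ _).trans (by rw [norm_smul])
      _ ≤ ‖z - p‖ + r * ‖v‖ := by gcongr
      _ < ρ := by linarith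
  have hfd : ∀ w ∈ ball p ρ, HasFDerivAt f (fderiv ℂ f w) w := fun w hw =>
    (hf.differentiableAt (hU.mem_nhds (hball w hw).2)).hasFDerivAt
  have hcirc : ∀ θ : ℝ, circleMap 0 r θ ∈ closedBall (0 : ℂ) r := fun θ => by
    simp [abs_of_pos hr]
  have hpath : ∀ z ∈ ball p (ρ / 2), Continuous fun θ : ℝ => f (z + circleMap 0 r θ • v) := by
    intro z hz
    rw [continuous_iff_continuousAt]
    intro θ
    have h := (hfd _ (hmem z hz _ (hcirc θ))).continuousAt
    exact ContinuousAt.comp (g := f) (f := fun θ : ℝ => z + circleMap 0 r θ • v) h (by fun_prop)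
  have hpath' : Continuous fun θ : ℝ => fderiv ℂ f (p + circleMap 0 r θ • v) := by
    rw [continuous_iff_continuousAt]
    intro θ
    have h := continuousAt_fderiv_of_differentiableOn hU hf
      (hball _ (hmem p (mem_ball_self (by positivity)) _ (hcirc θ))).2
    exact ContinuousAt.comp (g := fderiv ℂ f) (f := fun θ : ℝ => p + circleMap 0 r θ • v) h
      (by fun_prop)
  -- Cauchy kernel for the first derivative on a circle of radius r. The directional derivative
  -- becomes an integral of values of f, which can be differentiated in z under the integral sign.
  set k : ℝ → ℂ := fun θ => (2 * Real.pi * Complex.I)⁻¹ *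
    (deriv (circleMap 0 r) θ * (circleMap 0 r θ)⁻¹ ^ 2) with hk
  have hkc : Continuous k := by
    have h0 : ∀ θ, circleMap 0 r θ ≠ 0 := fun θ => circleMap_ne_center hr.ne'
    simp only [hk, deriv_circleMap]
    fun_prop (disch := simp [hr.ne'])
  have hformula : ∀ z ∈ ball p (ρ / 2), fderiv ℂ f z v =
      ∫ θ in (0 : ℝ)..2 * Real.pi, k θ • f (z + circleMap 0 r θ • v) := by
    intro z hz
    have hline : ∀ ζ ∈ closedBall (0 : ℂ) r, HasDerivAt (fun ζ : ℂ => f (z + ζ • v))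
        (fderiv ℂ f (z + ζ • v) v) ζ := fun ζ hζ => by
      have h2 : HasDerivAt (fun ζ : ℂ => z + ζ • v) v ζ := by
        simpa using ((hasDerivAt_id ζ).smul_const v).const_add z
      exact (hfd _ (hmem z hz ζ hζ)).comp_hasDerivAt ζ h2
    have hdc : DiffContOnCl ℂ (fun ζ : ℂ => f (z + ζ • v)) (ball 0 r) := by
      apply DifferentiableOn.diffContOnCl
      rw [closure_ball _ hr.ne']
      exact fun ζ hζ => (hline ζ hζ).differentiableAt.differentiableWithinAt
    have hC := hdc.circleIntegral_one_div_sub_center_pow_smul hr 1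
    have hder : deriv (fun ζ : ℂ => f (z + ζ • v)) 0 = fderiv ℂ f z v := by
      simpa using (hline 0 (mem_closedBall_self hr.le)).deriv
    rw [iteratedDeriv_one, hder] at hC
    have h2pi : (2 * Real.pi * Complex.I : ℂ) ≠ 0 := Complex.two_pi_I_ne_zero
    have : fderiv ℂ f z v = (2 * Real.pi * Complex.I : ℂ)⁻¹ •
        ∮ ζ in C(0, r), (1 / (ζ - 0) ^ (1 + 1)) • f (z + ζ • v) := by
      rw [hC, smul_smul, Nat.factorial_one, Nat.cast_one, div_one, inv_mul_cancel₀ h2pi, one_smul]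
    rw [this, circleIntegral, ← intervalIntegral.integral_smul]
    congr 1
    ext θ
    simp [hk, smul_smul, mul_assoc]
  have hs : ball p (ρ / 2) ∈ 𝓝 p := ball_mem_nhds _ (by positivity)
  have hI := intervalIntegral.hasFDerivAt_integral_of_dominated_of_fderiv_le (𝕜 := ℂ)
    (μ := MeasureTheory.volume) (a := 0) (b := 2 * Real.pi) (x₀ := p) (s := ball p (ρ / 2))
    (F := fun z θ => k θ • f (z + circleMap 0 r θ • v))
    (F' := fun z θ => k θ • fderiv ℂ f (z + circleMap 0 r θ • v))
    (bound := fun θ => ‖k θ‖ * (‖fderiv ℂ f p‖ + 1)) hs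
    (by
      filter_upwards [hs] with z hz
      exact (hkc.smul (hpath z hz)).aestronglyMeasurable)
    ((hkc.smul (hpath p (mem_ball_self (by positivity)))).intervalIntegrable _ _)
    (hkc.smul hpath').aestronglyMeasurable
    (Eventually.of_forall fun θ _ z hz => by
      rw [norm_smul]
      gcongr
      exact (hball _ (hmem z hz _ (hcirc θ))).1.le)
    ((by fun_prop : Continuous fun θ => ‖k θ‖ * (‖fderiv ℂ f p‖ + 1)).intervalIntegrable _ _)
    (Eventually.of_forall fun θ _ z hz => by
      refine HasFDerivAt.const_smul ?_ _
      exact (hfd _ (hmem z hz _ (hcirc θ))).comp z ((hasFDerivAt_id z).add_const _))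
  refine (hI.differentiableAt.congr_of_eventuallyEq ?_).differentiableWithinAt
  filter_upwards [hs] with z hz
  exact hformula z hz

/-- Holomorphic maps on open subsets of finite-dimensional spaces are smooth. -/
theorem contDiffOn_of_differentiableOn [CompleteSpace F] [FiniteDimensional ℂ E] {U : Set E}
    (hU : IsOpen U) (n : ℕ) : ∀ {f : E → F}, DifferentiableOn ℂ f U → ContDiffOn ℂ n f U := by
  induction n with
  | zero => exact fun hf => contDiffOn_zero.2 hf.continuousOn
  | succ n ih =>
    intro f hf
    rw [Nat.cast_succ]
    refine contDiffOn_succ_of_fderiv_apply hf (by simp) fun v => ?_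
    · refine (ih (differentiableOn_fderiv_apply hU hf v)).congr fun z hz => ?_
      rw [fderivWithin_of_isOpen hU hz]

theorem differentiableOn_fderiv [CompleteSpace F] [FiniteDimensional ℂ E] {U : Set E}
    (hU : IsOpen U) {f : E → F} (hf : DifferentiableOn ℂ f U) :
    DifferentiableOn ℂ (fderiv ℂ f) U :=
  ((contDiffOn_of_differentiableOn hU 2 hf).fderiv_of_isOpen hU (m := 1)
    (by norm_num)).differentiableOn (by norm_num)

/-- Strictness follows from continuity of the derivative and opens the way to the inverse function
theorem. -/
theorem hasStrictFDerivAt_of_differentiableOn {U : Set E} (hU : IsOpen U) {f : E → F}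
    (hf : DifferentiableOn ℂ f U) {p : E} (hp : p ∈ U) :
    HasStrictFDerivAt f (fderiv ℂ f p) p :=
  hasStrictFDerivAt_of_hasFDerivAt_of_continuousAt
    (by
      filter_upwards [hU.mem_nhds hp] with x hx
      exact (hf.differentiableAt (hU.mem_nhds hx)).hasFDerivAt)
    (continuousAt_fderiv_of_differentiableOn hU hf hp)

end SeveralVariables

/-! ### Maximum principles off zero sets, and openness of injective holomorphic maps -/

section MaximumPrinciple

open Metric Set

/-- Maximum principle for a continuous function which is holomorphic off its zeros. -/
theorem norm_le_of_differentiableAt_off_zeros {G : ℂ → ℂ} {c : ℂ} {R C : ℝ} (hR : 0 < R)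
    (hG : ContinuousOn G (closedBall c R))
    (hd : ∀ z ∈ ball c R, G z ≠ 0 → DifferentiableAt ℂ G z) (hC : ∀ z ∈ sphere c R, ‖G z‖ ≤ C)
    {z : ℂ} (hz : z ∈ ball c R) : ‖G z‖ ≤ C := by
  have hC0 : 0 ≤ C := by
    obtain ⟨w, hw⟩ := (NormedSpace.sphere_nonempty (x := c)).2 hR.le
    exact (norm_nonneg _).trans (hC w hw)
  by_cases h0 : G z = 0
  · simpa [h0] using hC0
  -- G is holomorphic on U, and each frontier point of U is on the sphere or is a zero of G, so the
  -- usual maximum principle on U suffices.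
  set U : Set ℂ := {w | w ∈ ball c R ∧ G w ≠ 0} with hUdef
  have hUo : IsOpen U :=
    (hG.mono ball_subset_closedBall).isOpen_inter_preimage isOpen_ball isOpen_ne
  have hUb : U ⊆ ball c R := fun w hw => hw.1
  have hcl : closure U ⊆ closedBall c R :=
    (closure_mono hUb).trans closure_ball_subset_closedBall
  refine Complex.norm_le_of_forall_mem_frontier_norm_le (isBounded_ball.subset hUb)
    ⟨fun w hw => (hd w hw.1 hw.2).differentiableWithinAt, hG.mono hcl⟩ (fun w hw => ?_)
    (subset_closure ⟨hz, h0⟩)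
  rw [hUo.frontier_eq] at hw
  by_cases hws : w ∈ sphere c R
  · exact hC w hws
  have hwb : w ∈ ball c R := by
    have h1 := mem_closedBall.1 (hcl hw.1)
    exact mem_ball.2 (lt_of_le_of_ne h1 hws)
  have : G w = 0 := by
    by_contra h
    exact hw.2 ⟨hwb, h⟩
  simpa [this] using hC0

/-- The maximum principle for a function `F` holomorphic off the zeros of a function `h`, itself
holomorphic off its zeros. -/
theorem norm_le_of_differentiableAt_off_zeros_of_aux {F h : ℂ → ℂ} {r : ℝ} (hr : 0 < r)
    (hF : ContinuousOn F (closedBall 0 1)) (hh : ContinuousOn h (closedBall 0 1))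
    (hd : ∀ z ∈ ball (0 : ℂ) 1, h z ≠ 0 → DifferentiableAt ℂ F z ∧ DifferentiableAt ℂ h z)
    (h0 : h 0 ≠ 0) (hC : ∀ z ∈ sphere (0 : ℂ) 1, ‖F z‖ ≤ r) : ‖F 0‖ ≤ r := by
  obtain ⟨M, hM⟩ := (isCompact_closedBall (0 : ℂ) 1).exists_bound_of_continuousOn hh
  -- The factor h makes F^m h vanish wherever F may fail to be holomorphic. Its cost M/‖h 0‖ does
  -- not depend on m, so it disappears on taking m-th roots.
  have key : ∀ m : ℕ, ‖F 0‖ ^ m * ‖h 0‖ ≤ r ^ m * M := fun m => by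
    have := norm_le_of_differentiableAt_off_zeros (G := fun z => F z ^ m * h z) (c := 0)
      (R := 1) (C := r ^ m * M) one_pos ((hF.pow m).mul hh)
      (fun z hz hne => by
        obtain ⟨h1, h2⟩ := hd z hz (right_ne_zero_of_mul hne)
        exact (h1.pow m).mul h2)
      (fun z hz => by
        rw [norm_mul, norm_pow]
        have h1 := hC z hz
        have h2 := hM z (sphere_subset_closedBall hz)
        gcongr) (mem_ball_self one_pos)
    simpa using this
  by_contra! hlt
  have h1 : 1 < ‖F 0‖ / r := by rwa [one_lt_div hr]
  obtain ⟨m, hm⟩ := pow_unbounded_of_one_lt (M / ‖h 0‖) h1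
  have h0' : 0 < ‖h 0‖ := norm_pos_iff.2 h0
  rw [div_pow, div_lt_div_iff₀ h0' (by positivity)] at hm
  linarith [key m]

variable {E : Type*} [NormedAddCommGroup E] [NormedSpace ℂ E]

/-- A continuous function on a ball which is holomorphic off its zeros and vanishes near a point
close to the centre vanishes near the centre. -/
theorem eq_zero_of_differentiableAt_off_zeros {H : E → ℂ} {c b : E} {δ : ℝ}
    (hH : ContinuousOn H (ball c δ))
    (hd : ∀ z ∈ ball c δ, H z ≠ 0 → DifferentiableAt ℂ H z) (hb : b ∈ ball c (δ / 3))
    (hb0 : ∀ᶠ z in 𝓝 b, H z = 0) {a : E} (ha : a ∈ ball c (δ / 3)) : H a = 0 := by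
  have hδ : 0 < δ := by
    have := (dist_nonneg (x := b) (y := c)).trans_lt hb
    linarith
  rcases eq_or_ne a b with rfl | hab
  · exact hb0.self_of_nhds
  have hda : dist a b < 2 * δ / 3 := by
    rw [mem_ball] at ha hb
    linarith [dist_triangle_right a b c]
  have hdpos : 0 < ‖a - b‖ := norm_pos_iff.2 (sub_ne_zero.2 hab)
  -- Complex line with b at ζ = 0 and a at ζ = 1. The disc of radius R > 1 stays in the ball because
  -- δ/3 + 2δ/3 = δ.
  set R : ℝ := 2 * δ / 3 / ‖a - b‖ with hRdef
  have hR1 : 1 < R := by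
    rw [hRdef, one_lt_div hdpos, ← dist_eq_norm]
    exact hda
  have hRpos : 0 < R := by linarith
  set ℓ : ℂ → E := fun ζ => b + ζ • (a - b) with hℓ
  have hℓc : Continuous ℓ := by fun_prop
  have hℓmem : ∀ ζ ∈ closedBall (0 : ℂ) R, ℓ ζ ∈ ball c δ := fun ζ hζ => by
    rw [mem_closedBall_zero_iff] at hζ
    rw [mem_ball, dist_eq_norm] at hb ⊢
    calc ‖ℓ ζ - c‖ = ‖(b - c) + ζ • (a - b)‖ := by simp only [hℓ]; congr 1; abel
      _ ≤ ‖b - c‖ + ‖ζ‖ * ‖a - b‖ := (norm_add_le _ _).trans (by rw [norm_smul])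
      _ ≤ ‖b - c‖ + R * ‖a - b‖ := by gcongr
      _ = ‖b - c‖ + 2 * δ / 3 := by rw [hRdef, div_mul_cancel₀ _ hdpos.ne']
      _ < δ := by linarith
  have hHℓ : ContinuousOn (fun ζ => H (ℓ ζ)) (closedBall 0 R) :=
    hH.comp hℓc.continuousOn hℓmem
  obtain ⟨M, hM⟩ := (isCompact_closedBall (0 : ℂ) R).exists_bound_of_continuousOn hHℓ
  have hnear : ∀ᶠ ζ in 𝓝 (0 : ℂ), H (ℓ ζ) = 0 := by
    have : Tendsto ℓ (𝓝 0) (𝓝 b) := by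
      have := hℓc.tendsto 0
      simpa [hℓ] using this
    exact this.eventually hb0
  -- H vanishes near ζ = 0, so it may be divided by any power ζ^k; this is a zero of infinite order,
  -- and R > 1 then forces H a = 0.
  have key : ∀ k : ℕ, ‖H a‖ * R ^ k ≤ M := fun k => by
    have hGat : ∀ ζ, ζ ∈ closedBall (0 : ℂ) R →
        ContinuousWithinAt (fun ζ => H (ℓ ζ) / ζ ^ k) (closedBall 0 R) ζ := fun ζ hζ => by
      rcases eq_or_ne ζ 0 with rfl | hne
      · refine ContinuousAt.continuousWithinAt ?_
        refine (continuousAt_const (y := (0 : ℂ))).congr ?_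
        filter_upwards [hnear] with ζ hζ
        rw [hζ, zero_div]
      · exact (hHℓ ζ hζ).div (by fun_prop) (pow_ne_zero _ hne)
    have := norm_le_of_differentiableAt_off_zeros (G := fun ζ => H (ℓ ζ) / ζ ^ k) (c := 0)
      (R := R) (C := M / R ^ k) hRpos hGat
      (fun ζ hζ hne => by
        have hne1 : H (ℓ ζ) ≠ 0 := fun h => hne (by simp [h])
        rcases eq_or_ne ζ 0 with rfl | hζ0
        · exact absurd hnear.self_of_nhds hne1
        · have h1 := hd _ (hℓmem ζ (ball_subset_closedBall hζ)) hne1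
          have h2 : DifferentiableAt ℂ ℓ ζ := by
            simp only [hℓ]; fun_prop
          exact (h1.comp ζ h2).div (by fun_prop) (pow_ne_zero _ hζ0))
      (fun ζ hζ => by
        rw [norm_div, norm_pow, mem_sphere_zero_iff_norm.1 hζ]
        gcongr
        exact hM ζ (sphere_subset_closedBall hζ))
      (z := 1) (by simpa using hR1)
    have h1 : ℓ 1 = a := by simp [hℓ]
    rw [h1, one_pow, div_one, le_div_iff₀ (by positivity)] at this
    exact this
  by_contra h0
  have h0' : 0 < ‖H a‖ := norm_pos_iff.2 h0
  obtain ⟨k, hk⟩ := pow_unbounded_of_one_lt (M / ‖H a‖) hR1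
  rw [div_lt_iff₀ h0'] at hk
  linarith [key k]

/-- A holomorphic function on a ball not vanishing at the centre vanishes nowhere locally. -/
theorem not_eventually_eq_zero_of_ne_zero {J : E → ℂ} {r : ℝ}
    (hJ : DifferentiableOn ℂ J (ball 0 r)) (h0 : J 0 ≠ 0) {p : E} (hp : p ∈ ball (0 : E) r) :
    ¬ ∀ᶠ z in 𝓝 p, J z = 0 := by
  intro hev
  -- The slice through 0 and p is convex, so the one-variable identity theorem carries vanishing
  -- near p back to the centre.
  set S : Set ℂ := (fun ζ : ℂ => ζ • p) ⁻¹' ball (0 : E) r with hS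
  have hSo : IsOpen S := isOpen_ball.preimage (by fun_prop)
  have hSc : IsPreconnected S := by
    have : Convex ℝ S := by
      have := (convex_ball (0 : E) r).is_linear_preimage
        (f := fun ζ : ℂ => ζ • p) ⟨fun x y => add_smul x y p, fun c x => by
          rw [smul_assoc]⟩
      exact this
    exact this.isPreconnected
  have hd : DifferentiableOn ℂ (fun ζ : ℂ => J (ζ • p)) S :=
    hJ.comp (by fun_prop) (mapsTo_preimage _ _)
  have h1S : (1 : ℂ) ∈ S := by simpa [hS] using hp
  have h0S : (0 : ℂ) ∈ S := by
    have : 0 < r := (norm_nonneg p).trans_lt (mem_ball_zero_iff.1 hp)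
    simpa [hS] using this
  have ht : Tendsto (fun ζ : ℂ => ζ • p) (𝓝 1) (𝓝 p) := by
    have : Continuous fun ζ : ℂ => ζ • p := by fun_prop
    simpa using this.tendsto 1
  have := (hd.analyticOnNhd hSo).eqOn_zero_of_preconnected_of_eventuallyEq_zero hSc h1S
    (ht.eventually hev) h0S
  simp at this
  exact h0 this

/-- The inverse of a continuous injection of a compact set is continuous. -/
theorem tendsto_invFunOn_of_isCompact {X Y : Type*} [TopologicalSpace X]
    [TopologicalSpace Y] [T2Space Y] [Nonempty X] {f : X → Y} {K : Set X} (hK : IsCompact K)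
    (hf : ContinuousOn f K) (hinj : InjOn f K) {w : Y} (hw : w ∈ f '' K) :
    Tendsto (Function.invFunOn f K) (𝓝[f '' K] w) (𝓝 (Function.invFunOn f K w)) := by
  refine hK.tendsto_nhds_of_unique_mapClusterPt ?_ fun x hx hcl => ?_
  · filter_upwards [self_mem_nhdsWithin] with y hy using Function.invFunOn_mem hy
  -- Uniqueness of cluster points: by continuity of f, a cluster point x of the inverse satisfies f
  -- x = w.
  · refine hinj hx (Function.invFunOn_mem hw) ?_
    rw [Function.invFunOn_eq hw]
    have hcl' : ClusterPt x (map (Function.invFunOn f K) (𝓝[f '' K] w)) := hcl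
    have hmap : Tendsto f (𝓝 x ⊓ map (Function.invFunOn f K) (𝓝[f '' K] w)) (𝓝 (f x)) := by
      refine (hf x hx).mono_left (le_inf inf_le_left (inf_le_right.trans ?_))
      rw [le_principal_iff, mem_map]
      filter_upwards [self_mem_nhdsWithin] with y hy using Function.invFunOn_mem hy
    have hmap' : Tendsto f (𝓝 x ⊓ map (Function.invFunOn f K) (𝓝[f '' K] w)) (𝓝 w) := by
      refine Tendsto.mono_left ?_ inf_le_right
      rw [tendsto_map'_iff]
      refine (tendsto_id.mono_left nhdsWithin_le_nhds : Tendsto id (𝓝[f '' K] w) (𝓝 w)).congr' ?_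
      filter_upwards [self_mem_nhdsWithin] with y hy
      exact (Function.invFunOn_eq hy).symm
    have := hcl'.neBot
    exact tendsto_nhds_unique hmap hmap'

variable [FiniteDimensional ℂ E]

/-- In a basis the determinant is a polynomial in the matrix entries; composed with the derivative,
this makes Jacobians holomorphic. -/
theorem differentiable_clm_det : Differentiable ℂ fun A : E →L[ℂ] E => A.det := by
  classical
  set b := Module.finBasis ℂ E
  have : (fun A : E →L[ℂ] E => A.det) = fun A : E →L[ℂ] E =>
      (LinearMap.toMatrix b b (A : E →ₗ[ℂ] E)).det := by
    ext A
    exact (LinearMap.det_toMatrix b _).symm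
  rw [this]
  simp only [Matrix.det_apply, LinearMap.toMatrix_apply]
  have hentry : ∀ i j, Differentiable ℂ fun A : E →L[ℂ] E => b.repr (A (b j)) i := fun i j => by
    have h1 : Differentiable ℂ fun A : E →L[ℂ] E => A (b j) := by fun_prop
    exact (LinearMap.toContinuousLinearMap (b.coord i)).differentiable.comp h1
  refine Differentiable.fun_sum fun σ _ => Differentiable.const_smul ?_ _
  intro A
  exact (HasFDerivAt.finsetProd fun i _ => (hentry (σ i) i A).hasFDerivAt).differentiableAt

/-- A local inverse is differentiable where it is continuous and the derivative is invertible. -/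
theorem hasFDerivAt_of_rightInverse {f ψ : E → E} {w : E} (hψ : ContinuousAt ψ w)
    (hf : DifferentiableAt ℂ f (ψ w)) (hdet : (fderiv ℂ f (ψ w)).det ≠ 0)
    (hfψ : ∀ᶠ y in 𝓝 w, f (ψ y) = y) :
    HasFDerivAt ψ (((fderiv ℂ f (ψ w)).toContinuousLinearEquivOfDetNeZero hdet).symm : E →L[ℂ] E)
      w := by
  refine HasFDerivAt.of_local_left_inverse (f := f) hψ ?_ hfψ
  exact hf.hasFDerivAt

/-- Injective holomorphic maps with nowhere locally vanishing Jacobian are open. -/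
theorem image_mem_nhds_of_injOn {f : E → E} {U V : Set E} (hU : IsOpen U)
    (hf : DifferentiableOn ℂ f U) (hinj : InjOn f U) {p : E} (hp : p ∈ U)
    (hJ : ¬ ∀ᶠ z in 𝓝 p, (fderiv ℂ f z).det = 0) (hV : V ∈ 𝓝 p) : f '' V ∈ 𝓝 (f p) := by
  have : ProperSpace E := FiniteDimensional.proper ℂ E
  obtain ⟨ε, hε, hεUV⟩ := Metric.nhds_basis_closedBall.mem_iff.1 (inter_mem (hU.mem_nhds hp) hV)
  set K := closedBall p ε with hKdef
  have hKU : K ⊆ U := hεUV.trans inter_subset_left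
  have hK : IsCompact K := isCompact_closedBall p ε
  have hfK : ContinuousOn f K := hf.continuousOn.mono hKU
  have hinjK : InjOn f K := hinj.mono hKU
  set A := f '' K with hA
  have hAc : IsClosed A := (hK.image_of_continuousOn hfK).isClosed
  suffices hmain : A ∈ 𝓝 (f p) from
    mem_of_superset hmain (image_mono (hεUV.trans inter_subset_right))
  by_contra hnot
  obtain ⟨δ, hδ, hsph⟩ : ∃ δ > 0, ∀ z ∈ sphere p ε, f z ∉ ball (f p) δ := by
    have hS : IsClosed (f '' sphere p ε) := ((isCompact_sphere p ε).image_of_continuousOn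
      (hfK.mono sphere_subset_closedBall)).isClosed
    have hpS : f p ∈ (f '' sphere p ε)ᶜ := by
      rintro ⟨z, hz, hzp⟩
      have := hinjK (sphere_subset_closedBall hz) (mem_closedBall_self hε.le) hzp
      rw [this, mem_sphere, dist_self] at hz
      exact hε.ne hz
    obtain ⟨δ, hδ, hsub⟩ := Metric.isOpen_iff.1 hS.isOpen_compl _ hpS
    exact ⟨δ, hδ, fun z hz hzb => hsub hzb (mem_image_of_mem f hz)⟩
  set ψ := Function.invFunOn f K with hψ
  have hψmem : ∀ w ∈ A, ψ w ∈ K := fun w hw => Function.invFunOn_mem hw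
  have hfψ : ∀ w ∈ A, f (ψ w) = w := fun w hw => Function.invFunOn_eq hw
  set J : E → ℂ := fun z => (fderiv ℂ f z).det with hJdef
  have hJd : ∀ z ∈ U, DifferentiableAt ℂ J z := fun z hz =>
    DifferentiableAt.comp (g := fun A : E →L[ℂ] E => A.det) (f := fderiv ℂ f) z
      (differentiable_clm_det _)
      ((differentiableOn_fderiv hU hf).differentiableAt (hU.mem_nhds hz))
  classical
  -- Radó-type argument: the Jacobian transported to the target and extended by 0 off the image is
  -- continuous near f p and holomorphic off its zeros. If the image missed points arbitrarily close
  -- to f p, H would vanish near f p, hence J near p.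
  set H : E → ℂ := fun w => if w ∈ A then J (ψ w) else 0 with hH
  -- The choice of δ keeps the preimage off the sphere, so the inverse function theorem applies
  -- inside K.
  have hregular : ∀ w ∈ A, w ∈ ball (f p) δ → J (ψ w) ≠ 0 → A ∈ 𝓝 w := fun w hw hwδ hJw => by
    have hzb : ψ w ∈ ball p ε := by
      refine mem_ball.2 (lt_of_le_of_ne (mem_closedBall.1 (hψmem w hw)) fun h => ?_)
      exact hsph (ψ w) h (by rwa [hfψ w hw])
    have hstr := hasStrictFDerivAt_of_differentiableOn hU hf (hKU (hψmem w hw))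
    have hmap := HasStrictFDerivAt.map_nhds_eq_of_equiv
      (f' := (fderiv ℂ f (ψ w)).toContinuousLinearEquivOfDetNeZero hJw) hstr
    rw [hfψ w hw] at hmap
    rw [← hmap]
    exact image_mem_map (mem_of_superset (isOpen_ball.mem_nhds hzb) ball_subset_closedBall)
  have hψt : ∀ w ∈ A, Tendsto ψ (𝓝[A] w) (𝓝 (ψ w)) := fun w hw =>
    tendsto_invFunOn_of_isCompact hK hfK hinjK hw
  have hHcont : ∀ w ∈ ball (f p) δ, ContinuousAt H w := fun w hwδ => by
    by_cases hw : w ∈ A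
    · have h1 : Tendsto H (𝓝[A] w) (𝓝 (J (ψ w))) := by
        refine (((hJd _ (hKU (hψmem w hw))).continuousAt.tendsto.comp (hψt w hw))).congr' ?_
        filter_upwards [self_mem_nhdsWithin] with y hy
        simp [hH, hy]
      by_cases hJw : J (ψ w) = 0
      · have h2 : Tendsto H (𝓝[Aᶜ] w) (𝓝 (J (ψ w))) := by
          rw [hJw]
          refine tendsto_const_nhds.congr' ?_
          filter_upwards [self_mem_nhdsWithin] with y hy
          simp only [hH, if_neg hy]
        have h3 := h1.sup h2
        rw [← nhdsWithin_union, union_compl_self, nhdsWithin_univ] at h3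
        simpa [ContinuousAt, hH, hw] using h3
      · have hAn := hregular w hw hwδ hJw
        rw [nhdsWithin_eq_nhds.2 hAn] at h1
        simpa [ContinuousAt, hH, hw] using h1
    · refine (continuousAt_const (y := (0 : ℂ))).congr ?_
      filter_upwards [hAc.isOpen_compl.mem_nhds hw] with y hy
      simp only [hH, if_neg hy]
  have hHd : ∀ w ∈ ball (f p) δ, H w ≠ 0 → DifferentiableAt ℂ H w := fun w hwδ hHw => by
    have hw : w ∈ A := by
      by_contra h
      simp [hH, h] at hHw
    have hJw : J (ψ w) ≠ 0 := by simpa [hH, hw] using hHw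
    have hAn := hregular w hw hwδ hJw
    have hψc : ContinuousAt ψ w := by
      have := hψt w hw
      rwa [nhdsWithin_eq_nhds.2 hAn] at this
    have hψd := (hasFDerivAt_of_rightInverse hψc
      (hf.differentiableAt (hU.mem_nhds (hKU (hψmem w hw)))) hJw
      (by filter_upwards [hAn] with y hy using hfψ y hy)).differentiableAt
    refine ((hJd _ (hKU (hψmem w hw))).comp w hψd).congr_of_eventuallyEq ?_
    filter_upwards [hAn] with y hy
    simp [hH, hy]
  obtain ⟨b, hb, hbA⟩ : ∃ b ∈ ball (f p) (δ / 3), b ∉ A := by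
    by_contra! hall
    exact hnot (mem_of_superset (ball_mem_nhds _ (by positivity)) hall)
  have hb0 : ∀ᶠ w in 𝓝 b, H w = 0 := by
    filter_upwards [hAc.isOpen_compl.mem_nhds hbA] with y hy
    simp only [hH, if_neg hy]
  refine hJ ?_
  have hfc : ContinuousAt f p := hf.continuousOn.continuousAt (hU.mem_nhds hp)
  filter_upwards [hfc.preimage_mem_nhds (ball_mem_nhds _ (by positivity : (0 : ℝ) < δ / 3)),
    closedBall_mem_nhds p hε] with z hz hzK
  have := eq_zero_of_differentiableAt_off_zeros (fun w hw => (hHcont w hw).continuousWithinAt)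
    hHd hb hb0 hz
  have hzA : f z ∈ A := mem_image_of_mem f hzK
  have hψz : ψ (f z) = z := hinjK.leftInvOn_invFunOn hzK
  simpa [hH, hzA, hψz] using this

end MaximumPrinciple

/-! ### Second-order expansions along curves through the origin -/

section SecondOrder

open Metric Set Asymptotics

variable {E F : Type*} [NormedAddCommGroup E] [NormedSpace ℂ E] [NormedAddCommGroup F]
  [NormedSpace ℂ F]

/-- Second-order Taylor expansion at the origin. -/
theorem isLittleO_second_order {f : E → F} (hf : ∀ᶠ z in 𝓝 (0 : E), DifferentiableAt ℂ f z)
    (hf' : DifferentiableAt ℂ (fderiv ℂ f) 0) (hf0 : f 0 = 0) :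
    (fun z => f z - fderiv ℂ f 0 z - (1 / 2 : ℂ) • fderiv ℂ (fderiv ℂ f) 0 z z)
      =o[𝓝 0] fun z => ‖z‖ ^ 2 := by
  refine isLittleO_iff.2 fun ε hε => ?_
  have h1 := hf'.hasFDerivAt.isLittleO.def hε
  obtain ⟨r, hr, hball⟩ := Metric.eventually_nhds_iff_ball.1 (h1.and hf)
  filter_upwards [ball_mem_nhds (0 : E) hr] with z hz
  set D := fderiv ℂ (fderiv ℂ f) 0
  have hmem : ∀ ζ ∈ closedBall (0 : ℂ) 1, ζ • z ∈ ball (0 : E) r := fun ζ hζ => by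
    rw [mem_closedBall_zero_iff] at hζ
    rw [mem_ball_zero_iff] at hz ⊢
    rw [norm_smul]
    exact (mul_le_of_le_one_left (norm_nonneg z) hζ).trans_lt hz
  -- The Taylor remainder at ζz has ζ-derivative of norm at most ε‖z‖², so the mean value inequality
  -- from ζ = 0 to ζ = 1 bounds it.
  have hderiv : ∀ ζ ∈ closedBall (0 : ℂ) 1, HasDerivWithinAt
      (fun ζ : ℂ => f (ζ • z) - ζ • fderiv ℂ f 0 z - (ζ ^ 2 / 2) • D z z)
      (fderiv ℂ f (ζ • z) z - fderiv ℂ f 0 z - ζ • D z z) (closedBall 0 1) ζ := fun ζ hζ => by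
    have h2 : HasDerivAt (fun ζ : ℂ => ζ • z) z ζ := by
      simpa using (hasDerivAt_id ζ).smul_const z
    have h3 := ((hball _ (hmem ζ hζ)).2.hasFDerivAt).comp_hasDerivAt ζ h2
    have h4 : HasDerivAt (fun ζ : ℂ => ζ • fderiv ℂ f 0 z) (fderiv ℂ f 0 z) ζ := by
      simpa using (hasDerivAt_id ζ).smul_const (fderiv ℂ f 0 z)
    have h5 : HasDerivAt (fun ζ : ℂ => (ζ ^ 2 / 2) • D z z) (ζ • D z z) ζ := by
      have : HasDerivAt (fun ζ : ℂ => ζ ^ 2 / 2) ζ ζ := by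
        simpa using (hasDerivAt_pow 2 ζ).div_const 2
      exact this.smul_const _
    exact ((h3.sub h4).sub h5).hasDerivWithinAt
  have hbound := (convex_closedBall (0 : ℂ) 1).norm_image_sub_le_of_norm_hasDerivWithin_le
    (C := ε * ‖z‖ ^ 2) hderiv (fun ζ hζ => by
      have h2 := (hball _ (hmem ζ hζ)).1
      rw [mem_closedBall_zero_iff] at hζ
      calc ‖fderiv ℂ f (ζ • z) z - fderiv ℂ f 0 z - ζ • D z z‖
          = ‖(fderiv ℂ f (ζ • z) - fderiv ℂ f 0 - D (ζ • z - 0)) z‖ := by simp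
        _ ≤ ‖fderiv ℂ f (ζ • z) - fderiv ℂ f 0 - D (ζ • z - 0)‖ * ‖z‖ :=
          ContinuousLinearMap.le_opNorm _ _
        _ ≤ ε * ‖ζ • z - 0‖ * ‖z‖ := by gcongr
        _ = ε * (‖ζ‖ * ‖z‖) * ‖z‖ := by rw [sub_zero, norm_smul]
        _ ≤ ε * (1 * ‖z‖) * ‖z‖ := by gcongr
        _ = ε * ‖z‖ ^ 2 := by ring)
    (mem_closedBall_self zero_le_one) (y := 1) (by simp)
  simpa [hf0] using hbound

theorem tendsto_inv_smul_of_hasDerivAt {u : ℂ → E} {v : E} (hu : HasDerivAt u v 0)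
    (hu0 : u 0 = 0) : Tendsto (fun ζ : ℂ => ζ⁻¹ • u ζ) (𝓝[≠] 0) (𝓝 v) := by
  have := hasDerivAt_iff_tendsto_slope_zero.1 hu
  simpa [hu0] using this

/-- Second-order behaviour of a map along a curve through the origin. -/
theorem tendsto_second_order {f : E → F} (hf : ∀ᶠ z in 𝓝 (0 : E), DifferentiableAt ℂ f z)
    (hf' : DifferentiableAt ℂ (fderiv ℂ f) 0) (hf0 : f 0 = 0) {u : ℂ → E} {v : E}
    (hu : HasDerivAt u v 0) (hu0 : u 0 = 0) :
    Tendsto (fun ζ : ℂ => (ζ ^ 2)⁻¹ • (f (u ζ) - fderiv ℂ f 0 (u ζ))) (𝓝[≠] 0)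
      (𝓝 ((1 / 2 : ℂ) • fderiv ℂ (fderiv ℂ f) 0 v v)) := by
  set D := fderiv ℂ (fderiv ℂ f) 0 with hD
  have hslope := tendsto_inv_smul_of_hasDerivAt hu hu0
  have huc : Tendsto u (𝓝[≠] 0) (𝓝 0) := by
    have := hu.continuousAt.tendsto
    rw [hu0] at this
    exact this.mono_left nhdsWithin_le_nhds
  have h1 : Tendsto (fun ζ : ℂ => (1 / 2 : ℂ) • D (ζ⁻¹ • u ζ) (ζ⁻¹ • u ζ)) (𝓝[≠] 0)
      (𝓝 ((1 / 2 : ℂ) • D v v)) := by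
    have hc : Continuous fun w : E => (1 / 2 : ℂ) • D w w := by fun_prop
    exact (hc.tendsto v).comp hslope
  have h2 : Tendsto (fun ζ : ℂ => (ζ ^ 2)⁻¹ •
      (f (u ζ) - fderiv ℂ f 0 (u ζ) - (1 / 2 : ℂ) • D (u ζ) (u ζ))) (𝓝[≠] 0) (𝓝 0) := by
    have h3 := (isLittleO_second_order hf hf' hf0).comp_tendsto huc
    have h4 : (fun ζ : ℂ => u ζ) =O[𝓝[≠] 0] fun ζ : ℂ => ζ := by
      have := (hu.isBigO_sub).mono (nhdsWithin_le_nhds (s := {0}ᶜ))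
      simpa [hu0] using this
    have h5 : (fun ζ : ℂ => f (u ζ) - fderiv ℂ f 0 (u ζ) - (1 / 2 : ℂ) • D (u ζ) (u ζ))
        =o[𝓝[≠] 0] fun ζ : ℂ => ζ ^ 2 := by
      refine h3.trans_isBigO ?_
      exact h4.norm_left.pow 2
    exact h5.tendsto_inv_smul_nhds_zero
  have h6 := h2.add h1
  rw [zero_add] at h6
  refine h6.congr' ?_
  filter_upwards [self_mem_nhdsWithin] with ζ hζ
  have hζ0 : ζ ≠ 0 := hζ
  simp only [map_smul, smul_apply, smul_sub, smul_smul]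
  rw [show (1 / 2 : ℂ) * (ζ⁻¹ * ζ⁻¹) = (ζ ^ 2)⁻¹ * (1 / 2) by field_simp]
  abel

/-- The inverse of an open injection is continuous. -/
theorem continuousAt_invFunOn {X Y : Type*} [TopologicalSpace X] [TopologicalSpace Y]
    [Nonempty X] {f : X → Y} {U : Set X} (hU : IsOpen U) (hinj : InjOn f U)
    (hopen : ∀ p ∈ U, ∀ V ∈ 𝓝 p, f '' V ∈ 𝓝 (f p)) {w : Y} (hw : w ∈ f '' U) :
    ContinuousAt (Function.invFunOn f U) w := by
  intro V hV
  have hmem := Function.invFunOn_mem hw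
  have := hopen _ hmem _ (inter_mem hV (hU.mem_nhds hmem))
  rw [Function.invFunOn_eq hw] at this
  rw [mem_map]
  filter_upwards [this]
  rintro _ ⟨z, hz, rfl⟩
  change Function.invFunOn f U (f z) ∈ V
  rw [hinj.leftInvOn_invFunOn hz.2]
  exact hz.1

end SecondOrder

/-! ### The transition map and its weighted average -/

section Transition

open Metric Set
open scoped ComplexConjugate

/-- The coefficient of `z₂²` in the first component of a map at the origin. -/
noncomputable def quadCoeff (f : Cn 2 → Cn 2) : ℂ :=
  (1 / 2 : ℂ) * (fderiv ℂ (fderiv ℂ f) 0 !₂[(0 : ℂ), 1] !₂[(0 : ℂ), 1]) 0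

/-- The analytic disc `ζ ↦ (ζ² z₁, ζ z₂)`. -/
noncomputable def weightedDisc (z : Cn 2) (ζ : ℂ) : Cn 2 :=
  ζ ^ 2 • !₂[z 0, (0 : ℂ)] + ζ • !₂[(0 : ℂ), z 1]

theorem weightedDisc_apply_zero (z : Cn 2) (ζ : ℂ) : weightedDisc z ζ 0 = ζ ^ 2 * z 0 := by
  simp [weightedDisc]

theorem weightedDisc_apply_one (z : Cn 2) (ζ : ℂ) : weightedDisc z ζ 1 = ζ * z 1 := by
  simp [weightedDisc]

theorem weightedDisc_zero (z : Cn 2) : weightedDisc z 0 = 0 := by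
  simp [weightedDisc]

theorem differentiable_weightedDisc (z : Cn 2) : Differentiable ℂ (weightedDisc z) := by
  unfold weightedDisc
  fun_prop

theorem hasDerivAt_weightedDisc_zero (z : Cn 2) :
    HasDerivAt (weightedDisc z) (z 1 • !₂[(0 : ℂ), 1]) 0 := by
  have h1 : HasDerivAt (fun ζ : ℂ => ζ ^ 2 • !₂[z 0, (0 : ℂ)]) 0 0 := by
    simpa using (hasDerivAt_pow 2 (0 : ℂ)).smul_const !₂[z 0, (0 : ℂ)]
  have h2 : HasDerivAt (fun ζ : ℂ => ζ • !₂[(0 : ℂ), z 1]) !₂[(0 : ℂ), z 1] 0 := by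
    simpa using (hasDerivAt_id (0 : ℂ)).smul_const !₂[(0 : ℂ), z 1]
  have h3 : (0 : Cn 2) + !₂[(0 : ℂ), z 1] = z 1 • !₂[(0 : ℂ), 1] := by
    ext i
    fin_cases i <;> simp
  rw [← h3]
  exact h1.add h2

theorem norm_weightedDisc_le (z : Cn 2) {ζ : ℂ} (hζ : ‖ζ‖ ≤ 1) : ‖weightedDisc z ζ‖ ≤ ‖z‖ := by
  rw [EuclideanSpace.norm_eq, EuclideanSpace.norm_eq, Fin.sum_univ_two, Fin.sum_univ_two,
    weightedDisc_apply_zero, weightedDisc_apply_one, norm_mul, norm_mul, norm_pow]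
  refine Real.sqrt_le_sqrt (add_le_add ?_ ?_) <;> gcongr
  · exact mul_le_of_le_one_left (norm_nonneg _) (pow_le_one₀ (norm_nonneg _) hζ)
  · exact mul_le_of_le_one_left (norm_nonneg _) hζ

theorem norm_mul_add_norm_mul_le (z w : Cn 2) :
    ‖z 0‖ * ‖w 0‖ + ‖z 1‖ * ‖w 1‖ ≤ ‖z‖ * ‖w‖ := by
  have h1 : ‖z‖ ^ 2 = ‖z 0‖ ^ 2 + ‖z 1‖ ^ 2 := by
    rw [EuclideanSpace.norm_sq_eq, Fin.sum_univ_two]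
  have h2 : ‖w‖ ^ 2 = ‖w 0‖ ^ 2 + ‖w 1‖ ^ 2 := by
    rw [EuclideanSpace.norm_sq_eq, Fin.sum_univ_two]
  refine abs_le_of_sq_le_sq' ?_ (by positivity) |>.2
  rw [mul_pow, h1, h2]
  nlinarith [sq_nonneg (‖z 0‖ * ‖w 1‖ - ‖z 1‖ * ‖w 0‖)]

/-- Schwarz-type estimate for the transition map `f⁻¹ ∘ g` between two univalent maps with
`g(𝔹²) ⊆ f(𝔹²)`, averaged over the circle action `(ζ² z₁, ζ z₂)`. -/
theorem norm_transition_average_le {f g : Cn 2 → Cn 2} {a b : ℂ} (ha : a ≠ 0)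
    (hf : DifferentiableOn ℂ f (B 2)) (hg : DifferentiableOn ℂ g (B 2)) (hinj : InjOn f (B 2))
    (hsub : g '' B 2 ⊆ f '' B 2) (hf0 : f 0 = 0) (hg0 : g 0 = 0)
    (hf' : HasFDerivAt f (a • ContinuousLinearMap.id ℂ (Cn 2)) 0)
    (hg' : HasFDerivAt g (b • ContinuousLinearMap.id ℂ (Cn 2)) 0)
    {z : Cn 2} (hz : z ∈ B 2) (hz0 : z ≠ 0) :
    ‖conj (z 0) * ((b * z 0 + z 1 ^ 2 * quadCoeff g - (b / a * z 1) ^ 2 * quadCoeff f) / a) +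
      conj (z 1) * (b / a * z 1)‖ ≤ ‖z‖ := by
  have h0B : (0 : Cn 2) ∈ B 2 := mem_ball_self one_pos
  have hBo : IsOpen (B 2) := isOpen_ball
  set J : Cn 2 → ℂ := fun z => (fderiv ℂ f z).det with hJ
  have hJd : DifferentiableOn ℂ J (B 2) := fun z hz =>
    (DifferentiableAt.comp (g := fun A : Cn 2 →L[ℂ] Cn 2 => A.det) (f := fderiv ℂ f) z
      (differentiable_clm_det _)
      ((differentiableOn_fderiv hBo hf).differentiableAt
        (hBo.mem_nhds hz))).differentiableWithinAt
  have hJ0 : J 0 ≠ 0 := by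
    have : J 0 = LinearMap.det (a • (LinearMap.id : Cn 2 →ₗ[ℂ] Cn 2)) := by
      simp only [hJ, hf'.fderiv]; rfl
    rw [this, LinearMap.det_smul, LinearMap.det_id, mul_one]
    exact pow_ne_zero _ ha
  have hopen : ∀ p ∈ B 2, ∀ V ∈ 𝓝 p, f '' V ∈ 𝓝 (f p) := fun p hp V hV =>
    image_mem_nhds_of_injOn hBo hf hinj hp (not_eventually_eq_zero_of_ne_zero hJd hJ0 hp) hV
  set ψ := Function.invFunOn f (B 2) with hψ
  have hψc : ∀ w ∈ f '' B 2, ContinuousAt ψ w := fun w hw =>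
    continuousAt_invFunOn hBo hinj hopen hw
  have hψm : ∀ w ∈ f '' B 2, ψ w ∈ B 2 := fun w hw => Function.invFunOn_mem hw
  have hfψ : ∀ w ∈ f '' B 2, f (ψ w) = w := fun w hw => Function.invFunOn_eq hw
  have hfo : ∀ w ∈ f '' B 2, f '' B 2 ∈ 𝓝 w := by
    rintro _ ⟨p, hp, rfl⟩
    exact hopen p hp _ (hBo.mem_nhds hp)
  set φ : Cn 2 → Cn 2 := fun w => ψ (g w) with hφ
  have hgm : ∀ w ∈ B 2, g w ∈ f '' B 2 := fun w hw => hsub (mem_image_of_mem g hw)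
  have hφm : ∀ w ∈ B 2, φ w ∈ B 2 := fun w hw => hψm _ (hgm w hw)
  have hfφ : ∀ w ∈ B 2, f (φ w) = g w := fun w hw => hfψ _ (hgm w hw)
  have hgd : ∀ w ∈ B 2, DifferentiableAt ℂ g w := fun w hw => hg.differentiableAt (hBo.mem_nhds hw)
  have hfd : ∀ w ∈ B 2, DifferentiableAt ℂ f w := fun w hw => hf.differentiableAt (hBo.mem_nhds hw)
  have hφc : ∀ w ∈ B 2, ContinuousAt φ w := fun w hw =>
    ContinuousAt.comp (g := ψ) (f := g) (hψc _ (hgm w hw)) (hgd w hw).continuousAt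
  -- Only this partial holomorphy of φ is used; zeros of J are absorbed by the maximum principle.
  have hφd : ∀ w ∈ B 2, J (φ w) ≠ 0 → DifferentiableAt ℂ φ w := fun w hw hne => by
    have h1 := hasFDerivAt_of_rightInverse (hψc _ (hgm w hw)) (hfd _ (hφm w hw)) hne
      (by filter_upwards [hfo _ (hgm w hw)] with y hy using hfψ y hy)
    exact DifferentiableAt.comp (g := ψ) (f := g) w h1.differentiableAt (hgd w hw)
  have hφ0 : φ 0 = 0 := by
    have : ψ (f 0) = 0 := hinj.leftInvOn_invFunOn h0B
    rw [hf0] at this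
    simp only [hφ, hg0, this]
  have hφ' : HasFDerivAt φ ((b / a) • ContinuousLinearMap.id ℂ (Cn 2)) 0 := by
    have hd := (hφd 0 h0B (by rwa [hφ0])).hasFDerivAt
    have h1 : HasFDerivAt (fun w => f (φ w)) ((a • ContinuousLinearMap.id ℂ (Cn 2)).comp
        (fderiv ℂ φ 0)) 0 := by
      refine HasFDerivAt.comp (0 : Cn 2) (g := f) (f := φ) ?_ hd
      rwa [hφ0]
    have h2 : HasFDerivAt g ((a • ContinuousLinearMap.id ℂ (Cn 2)).comp (fderiv ℂ φ 0)) 0 := by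
      refine h1.congr_of_eventuallyEq ?_
      filter_upwards [hBo.mem_nhds h0B] with w hw using (hfφ w hw).symm
    have h3 := h2.unique hg'
    have h4 : fderiv ℂ φ 0 = (b / a) • ContinuousLinearMap.id ℂ (Cn 2) := by
      ext1 w
      have h5 := DFunLike.congr_fun h3 w
      simp only [ContinuousLinearMap.comp_apply, smul_apply,
        ContinuousLinearMap.id_apply] at h5 ⊢
      rw [div_eq_inv_mul, mul_smul, ← h5, smul_smul, inv_mul_cancel₀ ha, one_smul]
    rwa [h4] at hd
  set C := weightedDisc z with hC
  have hCB : ∀ ζ ∈ closedBall (0 : ℂ) 1, C ζ ∈ B 2 := fun ζ hζ => by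
    rw [mem_ball_zero_iff] at hz ⊢
    exact (norm_weightedDisc_le z (mem_closedBall_zero_iff.1 hζ)).trans_lt hz
  have hC0 : C 0 = 0 := weightedDisc_zero z
  have hCd := differentiable_weightedDisc z
  have hC' := hasDerivAt_weightedDisc_zero z
  set e : Cn 2 := !₂[(0 : ℂ), 1] with he
  have hu' : HasDerivAt (fun ζ => φ (C ζ)) ((b / a * z 1) • e) 0 := by
    have h1 : HasFDerivAt φ ((b / a) • ContinuousLinearMap.id ℂ (Cn 2)) (C 0) := by rwa [hC0]
    have h2 := h1.comp_hasDerivAt (0 : ℂ) hC'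
    simpa [smul_smul, mul_comm, Function.comp_def] using h2
  have hu0 : φ (C 0) = 0 := by rw [hC0, hφ0]
  have hfev : ∀ᶠ w in 𝓝 (0 : Cn 2), DifferentiableAt ℂ f w := by
    filter_upwards [hBo.mem_nhds h0B] with w hw using hfd w hw
  have hgev : ∀ᶠ w in 𝓝 (0 : Cn 2), DifferentiableAt ℂ g w := by
    filter_upwards [hBo.mem_nhds h0B] with w hw using hgd w hw
  have hball : ∀ᶠ ζ in 𝓝[≠] (0 : ℂ), ζ ∈ ball (0 : ℂ) 1 :=
    nhdsWithin_le_nhds (ball_mem_nhds _ one_pos)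
  have htf := tendsto_second_order hfev
    ((differentiableOn_fderiv hBo hf).differentiableAt (hBo.mem_nhds h0B)) hf0 hu' hu0
  have htg := tendsto_second_order hgev
    ((differentiableOn_fderiv hBo hg).differentiableAt (hBo.mem_nhds h0B)) hg0 hC' hC0
  have hcoord : ∀ i : Fin 2, Continuous fun w : Cn 2 => w i := fun i => by fun_prop
  -- Since f ∘ φ = g, and the linear parts are a·id and b·id, a φ equals b C plus the second-order
  -- part of g along C minus that of f along φ ∘ C. Divide the first coordinate by ζ².
  have hlim0 : Tendsto (fun ζ : ℂ => (ζ ^ 2)⁻¹ * φ (C ζ) 0) (𝓝[≠] 0)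
      (𝓝 ((b * z 0 + z 1 ^ 2 * quadCoeff g - (b / a * z 1) ^ 2 * quadCoeff f) / a)) := by
    have h1 := (((hcoord 0).tendsto _).comp htg).sub (((hcoord 0).tendsto _).comp htf)
    have h2 := (h1.const_add (b * z 0)).div_const a
    have hval : (b * z 0 + (((1 / 2 : ℂ) • fderiv ℂ (fderiv ℂ g) 0 (z 1 • e) (z 1 • e)) 0 -
        ((1 / 2 : ℂ) • fderiv ℂ (fderiv ℂ f) 0 ((b / a * z 1) • e) ((b / a * z 1) • e)) 0)) / a
        = (b * z 0 + z 1 ^ 2 * quadCoeff g - (b / a * z 1) ^ 2 * quadCoeff f) / a := by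
      simp only [quadCoeff, map_smul, smul_apply, PiLp.smul_apply, smul_eq_mul, ← he]
      ring
    rw [hval] at h2
    refine h2.congr' ?_
    filter_upwards [hball, self_mem_nhdsWithin] with ζ hζ hne
    have hζ0 : ζ ≠ 0 := hne
    have hfu := hfφ (C ζ) (hCB ζ (ball_subset_closedBall hζ))
    simp only [Function.comp_apply, hfu, hf'.fderiv, hg'.fderiv, smul_apply,
      ContinuousLinearMap.id_apply, PiLp.smul_apply, PiLp.sub_apply, smul_eq_mul]
    rw [hC, weightedDisc_apply_zero]
    field_simp
    ring
  have hlim1 : Tendsto (fun ζ : ℂ => ζ⁻¹ * φ (C ζ) 1) (𝓝[≠] 0) (𝓝 (b / a * z 1)) := by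
    have h1 := ((hcoord 1).tendsto _).comp (tendsto_inv_smul_of_hasDerivAt hu' hu0)
    have h2 : ((b / a * z 1) • e) 1 = b / a * z 1 := by simp [he]
    rw [h2] at h1
    exact h1
  set F0 : ℂ := conj (z 0) *
    ((b * z 0 + z 1 ^ 2 * quadCoeff g - (b / a * z 1) ^ 2 * quadCoeff f) / a) +
      conj (z 1) * (b / a * z 1) with hF0
  set F1 : ℂ → ℂ := fun ζ => conj (z 0) * ((ζ ^ 2)⁻¹ * φ (C ζ) 0) +
    conj (z 1) * (ζ⁻¹ * φ (C ζ) 1) with hF1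
  -- The value at 0 is the limit just computed, so the singularity is removable.
  set F : ℂ → ℂ := Function.update F1 0 F0 with hF
  have hF1lim : Tendsto F1 (𝓝[≠] 0) (𝓝 F0) := (hlim0.const_mul _).add (hlim1.const_mul _)
  have hFc0 : ContinuousAt F 0 := continuousAt_update_same.2 hF1lim
  have hFne : ∀ ζ, ζ ≠ 0 → F =ᶠ[𝓝 ζ] F1 := fun ζ hζ => by
    filter_upwards [isOpen_ne.mem_nhds hζ] with w hw
    exact Function.update_of_ne hw _ _
  have hcoordd : ∀ (i : Fin 2) {u : ℂ → Cn 2} {ζ : ℂ}, DifferentiableAt ℂ u ζ →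
      DifferentiableAt ℂ (fun ζ => u ζ i) ζ := fun i u ζ hu =>
    differentiableAt_euclidean.1 hu i
  have hF1d : ∀ ζ ∈ closedBall (0 : ℂ) 1, ζ ≠ 0 → J (φ (C ζ)) ≠ 0 → DifferentiableAt ℂ F ζ :=
    fun ζ hζ hζ0 hne => by
      have h1 : DifferentiableAt ℂ (fun ζ => φ (C ζ)) ζ :=
        DifferentiableAt.comp (g := φ) (f := C) ζ (hφd _ (hCB ζ hζ) hne) (hCd ζ)
      have h2 : DifferentiableAt ℂ F1 ζ :=
        ((((differentiableAt_id.pow 2).inv (pow_ne_zero 2 hζ0)).mul (hcoordd 0 h1)).const_mul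
          _).add (((differentiableAt_id.inv hζ0).mul (hcoordd 1 h1)).const_mul _)
      exact h2.congr_of_eventuallyEq (hFne ζ hζ0)
  have hhc : ∀ ζ ∈ closedBall (0 : ℂ) 1, ContinuousAt (fun ζ => φ (C ζ)) ζ := fun ζ hζ =>
    ContinuousAt.comp (g := φ) (f := C) (hφc _ (hCB ζ hζ)) (hCd ζ).continuousAt
  have hJc : ∀ ζ ∈ closedBall (0 : ℂ) 1, ContinuousAt (fun ζ => J (φ (C ζ))) ζ := fun ζ hζ =>
    ContinuousAt.comp (g := J) (f := fun ζ => φ (C ζ))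
      (hJd.continuousOn.continuousAt (hBo.mem_nhds (hφm _ (hCB ζ hζ)))) (hhc ζ hζ)
  have h00 : J (φ (C 0)) ≠ 0 := by rwa [hu0]
  have hFd0 : DifferentiableAt ℂ F 0 := by
    refine (Complex.analyticAt_of_differentiable_on_punctured_nhds_of_continuousAt ?_
      hFc0).differentiableAt
    have hne : ∀ᶠ ζ in 𝓝[≠] (0 : ℂ), J (φ (C ζ)) ≠ 0 :=
      nhdsWithin_le_nhds ((hJc 0 (mem_closedBall_self zero_le_one)).eventually_ne h00)
    filter_upwards [hball, self_mem_nhdsWithin, hne] with ζ h1 h2 h3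
    exact hF1d ζ (ball_subset_closedBall h1) h2 h3
  have hFcont : ContinuousOn F (closedBall 0 1) := fun ζ hζ => by
    refine ContinuousAt.continuousWithinAt ?_
    rcases eq_or_ne ζ 0 with rfl | hζ0
    · exact hFc0
    · refine ContinuousAt.congr ?_ (hFne ζ hζ0).symm
      have hi := fun i : Fin 2 => ContinuousAt.comp (g := fun w : Cn 2 => w i)
        (f := fun ζ => φ (C ζ)) (hcoord i).continuousAt (hhc ζ hζ)
      exact (continuousAt_const.mul (((continuousAt_id.pow 2).inv₀ (pow_ne_zero 2 hζ0)).mul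
        (hi 0))).add (continuousAt_const.mul ((continuousAt_id.inv₀ hζ0).mul (hi 1)))
  have hmain := norm_le_of_differentiableAt_off_zeros_of_aux (F := F)
    (h := fun ζ => J (φ (C ζ))) (r := ‖z‖) (norm_pos_iff.2 hz0) hFcont
    (fun ζ hζ => (hJc ζ hζ).continuousWithinAt)
    (fun ζ hζ hne => by
      have hζ' := ball_subset_closedBall hζ
      constructor
      · rcases eq_or_ne ζ 0 with rfl | hζ0
        · exact hFd0
        · exact hF1d ζ hζ' hζ0 hne
      · have h1 : DifferentiableAt ℂ (fun ζ => φ (C ζ)) ζ :=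
          DifferentiableAt.comp (g := φ) (f := C) ζ (hφd _ (hCB ζ hζ') hne) (hCd ζ)
        exact DifferentiableAt.comp (g := J) (f := fun ζ => φ (C ζ)) ζ
          (hJd.differentiableAt (hBo.mem_nhds (hφm _ (hCB ζ hζ')))) h1)
    h00
    (fun ζ hζ => by
      have h1 : ‖ζ‖ = 1 := mem_sphere_zero_iff_norm.1 hζ
      have hζ0 : ζ ≠ 0 := by
        rintro rfl
        simp at h1
      have h2 : F ζ = F1 ζ := Function.update_of_ne hζ0 _ _
      have h3 := hφm _ (hCB ζ (sphere_subset_closedBall hζ))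
      rw [mem_ball_zero_iff] at h3
      rw [h2]
      calc ‖F1 ζ‖ ≤ ‖z 0‖ * ‖φ (C ζ) 0‖ + ‖z 1‖ * ‖φ (C ζ) 1‖ := by
            refine (norm_add_le _ _).trans_eq ?_
            simp [h1]
        _ ≤ ‖z‖ * ‖φ (C ζ)‖ := norm_mul_add_norm_mul_le _ _
        _ ≤ ‖z‖ * 1 := by gcongr
        _ = ‖z‖ := mul_one _)
  simpa [hF] using hmain

end Transition

/-! ### The sharp coefficient bound -/

section CoefficientBound

open Metric Set
open scoped ComplexConjugate

/-- Sharp change of the normalized coefficient between two members of a subordination chain. -/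
theorem norm_quadCoeff_sub_le {f g : Cn 2 → Cn 2} {a b : ℝ} (ha : 0 < a) (hb : 0 < b)
    (hf : DifferentiableOn ℂ f (B 2)) (hg : DifferentiableOn ℂ g (B 2)) (hinj : InjOn f (B 2))
    (hsub : g '' B 2 ⊆ f '' B 2) (hf0 : f 0 = 0) (hg0 : g 0 = 0)
    (hf' : HasFDerivAt f ((a : ℂ) • ContinuousLinearMap.id ℂ (Cn 2)) 0)
    (hg' : HasFDerivAt g ((b : ℂ) • ContinuousLinearMap.id ℂ (Cn 2)) 0) :
    ‖quadCoeff g / (b : ℂ) ^ 2 - quadCoeff f / (a : ℂ) ^ 2‖ ≤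
      3 * √3 / 2 * ((a / b - 1) / b) := by
  have ha' : (a : ℂ) ≠ 0 := by exact_mod_cast ha.ne'
  have hb' : (b : ℂ) ≠ 0 := by exact_mod_cast hb.ne'
  have h3 : √3 * √3 = 3 := Real.mul_self_sqrt (by norm_num)
  have h3pos : 0 < √3 := by positivity
  set β : ℂ := quadCoeff g / (b : ℂ) ^ 2 - quadCoeff f / (a : ℂ) ^ 2 with hβ
  -- The unimodular ω is the phase of β; giving it to z₁ makes conj(z₁) β positive, so nothing is
  -- lost on taking real parts.
  obtain ⟨ω, hω, hωβ⟩ : ∃ ω : ℂ, conj ω * ω = 1 ∧ conj ω * β = ‖β‖ := by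
    by_cases h : β = 0
    · exact ⟨1, by simp, by simp [h]⟩
    · have hn : (‖β‖ : ℂ) ≠ 0 := by exact_mod_cast norm_ne_zero_iff.2 h
      have hc : conj β * β = (‖β‖ : ℂ) ^ 2 := by
        rw [mul_comm, Complex.mul_conj, Complex.normSq_eq_norm_sq]
        norm_cast
      refine ⟨β / ‖β‖, ?_, ?_⟩
      · rw [map_div₀, Complex.conj_ofReal, div_mul_div_comm, hc]
        field_simp
      · rw [map_div₀, Complex.conj_ofReal, div_mul_eq_mul_div, hc]
        field_simp
  set κ : ℝ := 2 * √3 / 9 with hκ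
  have key : ∀ r ∈ Ioo (0 : ℝ) 1, b / a * (r + r ^ 2 * κ * (b * ‖β‖)) ≤ 1 := by
    rintro r ⟨hr0, hr1⟩
    -- The weights s² = 1/3, t² = 2/3 maximize s t² on the unit circle, and κ = s t² is the maximum.
    set s : ℝ := √3 / 3 with hs
    set t : ℝ := √(2 / 3) with ht
    have hs2 : s ^ 2 = 1 / 3 := by rw [hs]; nlinarith
    have ht2 : t ^ 2 = 2 / 3 := Real.sq_sqrt (by norm_num)
    set z : Cn 2 := !₂[((r * s : ℝ) : ℂ) * ω, ((r * t : ℝ) : ℂ)] with hz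
    have hz0 : z 0 = ((r * s : ℝ) : ℂ) * ω := rfl
    have hz1 : z 1 = ((r * t : ℝ) : ℂ) := rfl
    have hωn : ‖ω‖ ^ 2 = 1 := by
      have : ((‖ω‖ ^ 2 : ℝ) : ℂ) = 1 := by
        rw [← hω, mul_comm, Complex.mul_conj, Complex.normSq_eq_norm_sq]
      exact_mod_cast this
    have hzn : ‖z‖ = r := by
      have : ‖z‖ ^ 2 = r ^ 2 := by
        rw [EuclideanSpace.norm_sq_eq, Fin.sum_univ_two, hz0, hz1, norm_mul, mul_pow, hωn,
          Complex.norm_real, Complex.norm_real, Real.norm_eq_abs, Real.norm_eq_abs, sq_abs,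
          sq_abs, mul_pow, mul_pow, hs2, ht2]
        ring
      exact (pow_left_inj₀ (norm_nonneg z) hr0.le two_ne_zero).1 this
    have hzB : z ∈ B 2 := by rw [mem_ball_zero_iff, hzn]; exact hr1
    have hzne : z ≠ 0 := by
      rw [← norm_pos_iff, hzn]; exact hr0
    have h := norm_transition_average_le ha' hf hg hinj hsub hf0 hg0 hf' hg' hzB hzne
    have hval : conj (z 0) * ((b * z 0 + z 1 ^ 2 * quadCoeff g -
        (b / a * z 1) ^ 2 * quadCoeff f) / a) + conj (z 1) * (b / a * z 1) =
        ((b / a * (r ^ 2 + r ^ 3 * κ * (b * ‖β‖)) : ℝ) : ℂ) := by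
      have hQ : b * z 0 + z 1 ^ 2 * quadCoeff g - (b / a * z 1) ^ 2 * quadCoeff f =
          b * z 0 + z 1 ^ 2 * (b ^ 2 * β) := by
        rw [hβ]; field_simp; ring
      have hs2c : (s : ℂ) ^ 2 = 1 / 3 := by
        rw [← Complex.ofReal_pow, hs2]; norm_num
      have ht2c : (t : ℂ) ^ 2 = 2 / 3 := by
        rw [← Complex.ofReal_pow, ht2]; norm_num
      have hκs : (κ : ℂ) = s * t ^ 2 := by
        rw [ht2c, hκ, hs]; push_cast; ring
      rw [hQ, hz0, hz1, map_mul, Complex.conj_ofReal, Complex.conj_ofReal]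
      calc ((r * s : ℝ) : ℂ) * conj ω * ((b * (((r * s : ℝ) : ℂ) * ω) +
            ((r * t : ℝ) : ℂ) ^ 2 * (b ^ 2 * β)) / a) + ((r * t : ℝ) : ℂ) *
            (b / a * ((r * t : ℝ) : ℂ))
          = b / a * (r ^ 2 * (s ^ 2 * (conj ω * ω) + t ^ 2) +
              r ^ 3 * (s * t ^ 2) * (b * (conj ω * β))) := by
            push_cast; field_simp; ring
        _ = _ := by
            rw [hω, hωβ, hs2c, ← hκs, ht2c]; push_cast; ring
    rw [hval, Complex.norm_real, hzn] at h
    have h' := (le_abs_self _).trans h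
    have : r * (b / a * (r + r ^ 2 * κ * (b * ‖β‖))) ≤ r * 1 := by
      calc _ = b / a * (r ^ 2 + r ^ 3 * κ * (b * ‖β‖)) := by ring
        _ ≤ r * 1 := by rw [mul_one]; exact h'
    exact le_of_mul_le_mul_left this hr0
  -- The extremal point lies on the sphere, so it is reached by r → 1.
  have hlim : b / a * (1 + 1 ^ 2 * κ * (b * ‖β‖)) ≤ 1 := by
    have hc : Continuous fun r : ℝ => b / a * (r + r ^ 2 * κ * (b * ‖β‖)) := by fun_prop
    refine le_of_tendsto (hc.continuousWithinAt (s := Iio 1) (x := 1)).tendsto ?_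
    filter_upwards [Ioo_mem_nhdsLT zero_lt_one] with r hr using key r hr
  have h1 : κ * (b * ‖β‖) ≤ a / b - 1 := by
    have : 1 + 1 ^ 2 * κ * (b * ‖β‖) ≤ a / b := by
      rw [le_div_iff₀ hb]
      rw [div_mul_eq_mul_div, div_le_one ha] at hlim
      linarith
    linarith
  have hκinv : 3 * √3 / 2 * κ = 1 := by rw [hκ]; nlinarith
  calc ‖β‖ = 3 * √3 / 2 * ((κ * (b * ‖β‖)) / b) := by
        rw [show 3 * √3 / 2 * ((κ * (b * ‖β‖)) / b) = (3 * √3 / 2 * κ) * ((b * ‖β‖) / b) by ring,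
          hκinv, one_mul, mul_div_cancel_left₀ _ hb.ne']
    _ ≤ _ := by gcongr

theorem extend_mem_differentiableOn (f : Hol 2) :
    DifferentiableOn ℂ (extend (f : C(B 2, Cn 2))) (B 2) := f.2

/-- The disc `w ↦ (0, w)` lies in the ball. -/
theorem vecZero_mem_ball {w : ℂ} {r : ℝ} (hw : ‖w‖ < r) : (!₂[(0 : ℂ), w] : Cn 2) ∈ ball 0 r := by
  rw [mem_ball_zero_iff, EuclideanSpace.norm_eq, Fin.sum_univ_two]
  simpa [Real.sqrt_sq] using hw

theorem vecZero_eq_smul (w : ℂ) : (!₂[(0 : ℂ), w] : Cn 2) = w • !₂[(0 : ℂ), 1] := by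
  ext i
  fin_cases i <;> simp

theorem differentiableOn_vertical (f : Hol 2) :
    DifferentiableOn ℂ (fun w : ℂ => extend (f : C(B 2, Cn 2)) !₂[(0 : ℂ), w] 0) (ball 0 1) := by
  intro w hw
  have h1 := (extend_mem_differentiableOn f).differentiableAt
    (isOpen_ball.mem_nhds (vecZero_mem_ball (mem_ball_zero_iff.1 hw)))
  have h2 : DifferentiableAt ℂ (fun w : ℂ => (!₂[(0 : ℂ), w] : Cn 2)) w := by
    rw [funext vecZero_eq_smul]
    fun_prop
  exact (differentiableAt_euclidean.1 (DifferentiableAt.comp (g := extend (f : C(B 2, Cn 2)))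
    w h1 h2) 0).differentiableWithinAt

/-- The second derivative of a map along a complex line through the origin. -/
theorem iteratedDeriv_two_comp_line {E F G : Type*} [NormedAddCommGroup E] [NormedSpace ℂ E]
    [FiniteDimensional ℂ E] [NormedAddCommGroup F] [NormedSpace ℂ F] [CompleteSpace F]
    [NormedAddCommGroup G] [NormedSpace ℂ G] {h : E → F} {U : Set E} (hU : IsOpen U)
    (h0 : (0 : E) ∈ U) (hd : DifferentiableOn ℂ h U) (ℓ : F →L[ℂ] G) (e : E) :
    iteratedDeriv 2 (fun w : ℂ => ℓ (h (w • e))) 0 = ℓ (fderiv ℂ (fderiv ℂ h) 0 e e) := by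
  have hline : ∀ w : ℂ, HasDerivAt (fun w : ℂ => w • e) e w := fun w => by
    simpa using (hasDerivAt_id w).smul_const e
  have hmem : ∀ᶠ w in 𝓝 (0 : ℂ), w • e ∈ U := by
    have hc : Continuous fun w : ℂ => w • e := by fun_prop
    refine hc.continuousAt.eventually_mem (hU.mem_nhds ?_)
    simpa using h0
  have hev : deriv (fun w : ℂ => ℓ (h (w • e))) =ᶠ[𝓝 0]
      fun w : ℂ => ℓ (fderiv ℂ h (w • e) e) := by
    filter_upwards [hmem] with w hw
    have h1 := (hd.differentiableAt (hU.mem_nhds hw)).hasFDerivAt.comp_hasDerivAt w (hline w)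
    exact (ℓ.hasFDerivAt.comp_hasDerivAt w h1).deriv
  rw [iteratedDeriv_succ, iteratedDeriv_one, hev.deriv_eq]
  have h1 : HasFDerivAt (fderiv ℂ h) (fderiv ℂ (fderiv ℂ h) 0) ((0 : ℂ) • e) := by
    rw [zero_smul]
    exact ((differentiableOn_fderiv hU hd).differentiableAt (hU.mem_nhds h0)).hasFDerivAt
  have h2 := (ℓ.comp (ContinuousLinearMap.apply ℂ F e)).hasFDerivAt.comp_hasDerivAt (0 : ℂ)
    (h1.comp_hasDerivAt (0 : ℂ) (hline 0))
  exact h2.deriv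

/-- The one-variable form suits Cauchy estimates and continuity, the second-differential form suits
composition with transition maps. -/
theorem coeffL_eq_quadCoeff (f : Hol 2) : coeffL f = quadCoeff (extend (f : C(B 2, Cn 2))) := by
  have h1 : (fun w : ℂ => extend (f : C(B 2, Cn 2)) !₂[(0 : ℂ), w] 0) = fun w : ℂ =>
      EuclideanSpace.proj (𝕜 := ℂ) (0 : Fin 2)
        (extend (f : C(B 2, Cn 2)) (w • (!₂[(0 : ℂ), 1] : Cn 2))) := by
    ext w
    rw [vecZero_eq_smul]
    rfl
  rw [coeffL, quadCoeff, h1, iteratedDeriv_two_comp_line isOpen_ball (mem_ball_self one_pos)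
    (extend_mem_differentiableOn f)]
  rfl

theorem extend_add (f g : Hol 2) : extend ((f + g : Hol 2) : C(B 2, Cn 2)) =
    extend (f : C(B 2, Cn 2)) + extend (g : C(B 2, Cn 2)) := by
  ext1 z
  by_cases hz : z ∈ B 2
  · simp [extend_of_mem _ hz]
  · simp [extend, hz]

theorem extend_smul (c : ℂ) (f : Hol 2) : extend ((c • f : Hol 2) : C(B 2, Cn 2)) =
    c • extend (f : C(B 2, Cn 2)) := by
  ext1 z
  by_cases hz : z ∈ B 2
  · simp [extend_of_mem _ hz]
  · simp [extend, hz]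

theorem contDiffAt_vertical (f : Hol 2) :
    ContDiffAt ℂ 2 (fun w : ℂ => extend (f : C(B 2, Cn 2)) !₂[(0 : ℂ), w] 0) 0 :=
  ((differentiableOn_vertical f).analyticAt (ball_mem_nhds _ one_pos)).contDiffAt

theorem coeffL_add (f g : Hol 2) : coeffL (f + g) = coeffL f + coeffL g := by
  have : (fun w : ℂ => extend ((f + g : Hol 2) : C(B 2, Cn 2)) !₂[(0 : ℂ), w] 0) =
      (fun w : ℂ => extend (f : C(B 2, Cn 2)) !₂[(0 : ℂ), w] 0) +
        fun w : ℂ => extend (g : C(B 2, Cn 2)) !₂[(0 : ℂ), w] 0 := by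
    ext w
    rw [extend_add]
    rfl
  rw [coeffL, this, iteratedDeriv_add (contDiffAt_vertical f) (contDiffAt_vertical g), mul_add]
  rfl

theorem coeffL_smul (c : ℂ) (f : Hol 2) : coeffL (c • f) = c * coeffL f := by
  have : (fun w : ℂ => extend ((c • f : Hol 2) : C(B 2, Cn 2)) !₂[(0 : ℂ), w] 0) =
      c • (fun w : ℂ => extend (f : C(B 2, Cn 2)) !₂[(0 : ℂ), w] 0) := by
    ext w
    rw [extend_smul]
    rfl
  rw [coeffL, this, iteratedDeriv_const_smul (contDiffAt_vertical f) c, coeffL, smul_eq_mul]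
  ring

/-- Cauchy's estimate on the circle of radius 1/2 gives 2M/(1/2)² = 8M for the second derivative,
halved by the factor 1/2. This supplies continuity in the compact-open topology. -/
theorem norm_coeffL_le (f : Hol 2) {M : ℝ}
    (hM : ∀ z : B 2, ‖(z : Cn 2)‖ ≤ 1 / 2 → ‖(f : C(B 2, Cn 2)) z‖ ≤ M) :
    ‖coeffL f‖ ≤ 4 * M := by
  have hsub : closedBall (0 : ℂ) (1 / 2) ⊆ ball 0 1 := closedBall_subset_ball (by norm_num)
  have h := Complex.norm_iteratedDeriv_le_of_forall_mem_sphere_norm_le (n := 2) (c := 0)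
    (R := 1 / 2) (C := M) (f := fun w : ℂ => extend (f : C(B 2, Cn 2)) !₂[(0 : ℂ), w] 0)
    (by norm_num)
    (((differentiableOn_vertical f).mono hsub).diffContOnCl_ball subset_rfl)
    (fun w hw => by
      have hw' : ‖w‖ = 1 / 2 := mem_sphere_zero_iff_norm.1 hw
      have hmem : (!₂[(0 : ℂ), w] : Cn 2) ∈ B 2 := vecZero_mem_ball (by rw [hw']; norm_num)
      rw [extend_of_mem _ hmem]
      refine (PiLp.norm_apply_le _ _).trans (hM _ ?_)
      simp [EuclideanSpace.norm_eq, Fin.sum_univ_two, hw'])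
  rw [coeffL, norm_mul]
  norm_num at h ⊢
  linarith

/-- The coefficient functional as a continuous linear functional. -/
noncomputable def coeffLCLM : Hol 2 →L[ℂ] ℂ where
  toFun := coeffL
  map_add' := coeffL_add
  map_smul' c f := by simp [coeffL_smul]
  cont := by
    let l : Hol 2 →+ ℂ := AddMonoidHom.mk' coeffL coeffL_add
    refine continuous_of_continuousAt_zero l ?_
    rw [Metric.continuousAt_iff']
    intro ε hε
    have hK : IsCompact ((↑) ⁻¹' closedBall (0 : Cn 2) (1 / 2) : Set (B 2)) := by
      rw [Subtype.isCompact_iff, Subtype.image_preimage_coe, inter_eq_right.2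
        (closedBall_subset_ball (by norm_num))]
      exact isCompact_closedBall _ _
    have hval : Tendsto (fun f : Hol 2 => (f : C(B 2, Cn 2))) (𝓝 0) (𝓝 0) :=
      continuous_subtype_val.tendsto 0
    have hu := ContinuousMap.tendsto_iff_forall_isCompact_tendstoUniformlyOn.1 hval _ hK
    filter_upwards [Metric.tendstoUniformlyOn_iff.1 hu (ε / 8) (by positivity)] with f hf
    have : ‖coeffL f‖ ≤ 4 * (ε / 8) := norm_coeffL_le f fun z hz => by
      have := hf z (by simpa using hz)
      simpa using this.le
    rw [map_zero, dist_zero_right]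
    change ‖coeffL f‖ < ε
    linarith

theorem coeffLCLM_apply (f : Hol 2) : coeffLCLM f = coeffL f := rfl

theorem image_extend (f : Hol 2) :
    extend (f : C(B 2, Cn 2)) '' B 2 = range (f : C(B 2, Cn 2)) := by
  ext w
  constructor
  · rintro ⟨z, hz, rfl⟩
    exact ⟨⟨z, hz⟩, (extend_of_mem _ hz).symm⟩
  · rintro ⟨⟨z, hz⟩, rfl⟩
    exact ⟨z, hz, extend_of_mem _ hz⟩

theorem injOn_extend {f : Hol 2} (hf : IsUnivalent f) :
    InjOn (extend (f : C(B 2, Cn 2))) (B 2) := by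
  intro z hz w hw h
  rw [extend_of_mem _ hz, extend_of_mem _ hw] at h
  exact congrArg Subtype.val (hf h)

theorem extend_zero {f : Hol 2} (hf : (f : C(B 2, Cn 2)) (origin 2) = 0) :
    extend (f : C(B 2, Cn 2)) 0 = 0 := by
  rw [extend_of_mem _ (mem_ball_self one_pos)]
  exact hf

theorem norm_coeffL_chain_sub_le {c : ℝ≥0 → Hol 2} (hc : IsNormalizedLoewnerChain c)
    {s t : ℝ≥0} (hst : s ≤ t) :
    ‖coeffL (c s) / (Real.exp s : ℂ) ^ 2 - coeffL (c t) / (Real.exp t : ℂ) ^ 2‖ ≤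
      3 * √3 / 2 * ((Real.exp t / Real.exp s - 1) / Real.exp s) := by
  rw [coeffL_eq_quadCoeff, coeffL_eq_quadCoeff]
  refine norm_quadCoeff_sub_le (Real.exp_pos _) (Real.exp_pos _) (extend_mem_differentiableOn _)
    (extend_mem_differentiableOn _) (injOn_extend (hc.univalent t)) ?_
    (extend_zero (hc.map_origin t)) (extend_zero (hc.map_origin s)) (hc.deriv_origin t)
    (hc.deriv_origin s)
  rw [image_extend, image_extend]
  exact hc.range_subset s t hst

/-- The sharp coefficient bound on `S⁰(𝔹²)`. -/
theorem norm_coeffL_le_of_mem_classS0 {f : Hol 2} (hf : f ∈ classS0 2) :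
    ‖coeffL f‖ ≤ 3 * √3 / 2 := by
  obtain ⟨-, c, ⟨hc, hnormal⟩, rfl⟩ := hf
  set K : ℝ := 3 * √3 / 2 with hK
  have hKpos : 0 < K := by positivity
  set p : ℝ≥0 → ℂ := fun t => coeffL (c t) / (Real.exp t : ℂ) ^ 2 with hp
  have hp0 : p 0 = coeffL (c 0) := by simp [hp]
  -- One long step would give a bound growing like e^t. Equal steps of length h give a geometric
  -- series, K(e^h - 1) Σ e^{-kh} = K e^h (1 - e^{-Nh}) over k < N, which stays bounded.
  have hstep : ∀ h : ℝ≥0, 0 < h → ‖p 0‖ ≤ K * Real.exp h := fun h hh => by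
    have hind : ∀ N : ℕ, ‖p 0‖ ≤ ‖p (N * h)‖ + K * Real.exp h * (1 - Real.exp (-(N * h))) := by
      intro N
      induction N with
      | zero => simp
      | succ N ih =>
        have hle : (N : ℝ≥0) * h ≤ ((N + 1 : ℕ) : ℝ≥0) * h := by
          gcongr
          simp
        have h1 : ‖p (N * h) - p ((N + 1 : ℕ) * h)‖ ≤ _ := norm_coeffL_chain_sub_le hc hle
        have h2 : ‖p (N * h)‖ ≤ ‖p ((N + 1 : ℕ) * h)‖ + K * ((Real.exp h - 1) *
            Real.exp (-(N * h))) := by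
          have h3 : Real.exp (((N + 1 : ℕ) : ℝ≥0) * h : ℝ≥0) / Real.exp ((N : ℝ≥0) * h : ℝ≥0) =
              Real.exp h := by
            rw [← Real.exp_sub]
            congr 1
            push_cast
            ring
          rw [h3, div_eq_mul_inv (Real.exp h - 1), ← Real.exp_neg] at h1
          have h4 := norm_sub_norm_le (p (N * h)) (p ((N + 1 : ℕ) * h))
          push_cast at h1 h4 ⊢
          rw [← hK] at h1
          linarith
        have h5 : Real.exp (-((N + 1 : ℕ) * h : ℝ)) = Real.exp (-(N * h)) * Real.exp (-h) := by
          rw [← Real.exp_add]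
          congr 1
          push_cast
          ring
        have h6 : Real.exp h * Real.exp (-h) = 1 := by rw [← Real.exp_add]; simp
        rw [h5]
        have h7 : K * Real.exp h * (1 - Real.exp (-(N * h)) * Real.exp (-h)) =
            K * Real.exp h * (1 - Real.exp (-(N * h))) +
              K * ((Real.exp h - 1) * Real.exp (-(N * h))) := by
          linear_combination (-K * Real.exp (-(N * h : ℝ))) * h6
        linarith
    obtain ⟨g, φ, hφ, hlim⟩ := hnormal
      (fun k => (Real.exp (-((k * h : ℝ≥0) : ℝ)) : ℂ) • c (k * h)) fun k => ⟨k * h, rfl⟩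
    have hL := (coeffLCLM.continuous.tendsto g).comp hlim
    have hexp : Tendsto (fun j => (Real.exp (-((φ j * h : ℝ≥0) : ℝ)) : ℂ)) atTop (𝓝 0) := by
      have h1 : Tendsto (fun j => ((φ j * h : ℝ≥0) : ℝ)) atTop atTop := by
        have h2 : Tendsto (fun j => (φ j : ℝ)) atTop atTop :=
          tendsto_natCast_atTop_atTop.comp hφ.tendsto_atTop
        have h3 := h2.atTop_mul_const (show (0 : ℝ) < h from hh)
        simpa using h3
      have h2 := Real.tendsto_exp_neg_atTop_nhds_zero.comp h1
      have h3 := (Complex.continuous_ofReal.tendsto 0).comp h2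
      simpa [Function.comp_def] using h3
    -- p(t) is e^{-t} times the functional at e^{-t} c_t, and the latter converges along the
    -- subsequence supplied by normality.
    have hpl : Tendsto (fun j => p (φ j * h)) atTop (𝓝 0) := by
      have h1 := hexp.mul hL
      rw [zero_mul] at h1
      refine h1.congr fun j => ?_
      simp only [Function.comp_apply, coeffLCLM_apply, coeffL_smul, hp]
      rw [Real.exp_neg]
      push_cast
      field_simp
    refine le_of_tendsto_of_tendsto' tendsto_const_nhds
      (b := atTop) (g := fun j => ‖p (φ j * h)‖ + K * Real.exp h) ?_ fun j => ?_
    · simpa using hpl.norm.add_const (K * Real.exp h)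
    · refine (hind (φ j)).trans ?_
      have := (Real.exp_pos (-(φ j * h : ℝ))).le
      have h2 : K * Real.exp h * (1 - Real.exp (-(φ j * h))) ≤ K * Real.exp h * 1 := by
        gcongr
        linarith
      linarith
  rw [← hp0]
  have hlim : Tendsto (fun h : ℝ≥0 => K * Real.exp h) (𝓝[>] 0) (𝓝 K) := by
    have hcont : Continuous fun h : ℝ≥0 => K * Real.exp h := by fun_prop
    have := hcont.tendsto 0
    simp only [NNReal.coe_zero, Real.exp_zero, mul_one] at this
    exact this.mono_left nhdsWithin_le_nhds
  refine ge_of_tendsto hlim ?_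
  filter_upwards [self_mem_nhdsWithin] with h hh using hstep h hh

end CoefficientBound

/-! ### The shear: starlikeness, membership in the class, extremality -/

section Shear

open Metric Set

/-- The left side is ‖Φ⁻¹(τ Φ(z))‖² in real coordinates, with a = z₁, d = K z₂², Y = |z₂|². It is
nondecreasing in τ wherever it is below 1, so moving from τ = 1 towards 0 it can never climb to 1.
-/
theorem norm_sq_radial_lt_one {a₁ a₂ d₁ d₂ Y : ℝ} (hY : 0 ≤ Y)
    (hd : d₁ ^ 2 + d₂ ^ 2 = 27 / 4 * Y ^ 2) (h1 : a₁ ^ 2 + a₂ ^ 2 + Y < 1) {τ : ℝ}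
    (hτ0 : 0 ≤ τ) (hτ1 : τ ≤ 1) :
    (τ * a₁ + τ * (1 - τ) * d₁) ^ 2 + (τ * a₂ + τ * (1 - τ) * d₂) ^ 2 + τ ^ 2 * Y < 1 := by
  set N : ℝ → ℝ := fun τ =>
    (τ * a₁ + τ * (1 - τ) * d₁) ^ 2 + (τ * a₂ + τ * (1 - τ) * d₂) ^ 2 + τ ^ 2 * Y with hN
  have hN1 : N 1 < 1 := by simpa [hN] using h1
  have hNc : Continuous N := by fun_prop
  have hu : ∀ a d τ : ℝ, HasDerivAt (fun τ : ℝ => (τ * a + τ * (1 - τ) * d) ^ 2)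
      (2 * (τ * a + τ * (1 - τ) * d) * (a + (1 - 2 * τ) * d)) τ := fun a d τ => by
    have h2 : HasDerivAt (fun τ : ℝ => τ * (1 - τ)) (1 - 2 * τ) τ := by
      convert! (hasDerivAt_id τ).mul ((hasDerivAt_const τ (1 : ℝ)).sub (hasDerivAt_id τ)) using 1
      simp
      ring
    have h3 : HasDerivAt (fun τ : ℝ => τ * a + τ * (1 - τ) * d) (a + (1 - 2 * τ) * d) τ := by
      convert! ((hasDerivAt_id τ).mul_const a).add (h2.mul_const d) using 1
      simp
    convert! h3.pow 2 using 1
    simp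
  have hNd : ∀ τ, HasDerivAt N (2 * (τ * a₁ + τ * (1 - τ) * d₁) * (a₁ + (1 - 2 * τ) * d₁) +
      2 * (τ * a₂ + τ * (1 - τ) * d₂) * (a₂ + (1 - 2 * τ) * d₂) + 2 * τ * Y) τ := fun τ => by
    have h4 : HasDerivAt (fun τ : ℝ => τ ^ 2 * Y) (2 * τ * Y) τ := by
      simpa using (hasDerivAt_pow 2 τ).mul_const Y
    exact ((hu a₁ d₁ τ).add (hu a₂ d₂ τ)).add h4
  by_contra! hge
  -- Take the last σ with N σ ≥ 1: beyond it N < 1, hence N is monotone on [σ, 1], contradicting N 1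
  -- < 1.
  have hS : IsCompact {t ∈ Icc τ 1 | 1 ≤ N t} :=
    isCompact_Icc.inter_right (isClosed_le continuous_const hNc)
  obtain ⟨σ, ⟨hσmem, hσN⟩, hσmax⟩ := hS.exists_isGreatest ⟨τ, ⟨le_rfl, hτ1⟩, hge⟩
  have hmono : MonotoneOn N (Icc σ 1) := by
    refine monotoneOn_of_deriv_nonneg (convex_Icc σ 1) hNc.continuousOn
      (fun t _ => (hNd t).differentiableAt.differentiableWithinAt) fun t ht => ?_
    rw [interior_Icc] at ht
    have ht0 : 0 < t := (hτ0.trans hσmem.1).trans_lt ht.1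
    have hNt : N t < 1 := by
      by_contra! h
      exact (hσmax ⟨⟨hσmem.1.trans ht.1.le, ht.2.le⟩, h⟩).not_gt ht.1
    rw [(hNd t).deriv]
    set u₁ := t * a₁ + t * (1 - t) * d₁ with hu₁
    set u₂ := t * a₂ + t * (1 - t) * d₂ with hu₂
    have hNt' : N t = u₁ ^ 2 + u₂ ^ 2 + t ^ 2 * Y := rfl
    set x := u₁ ^ 2 + u₂ ^ 2 with hx
    set y := t ^ 2 * Y with hy
    have hx0 : 0 ≤ x := by positivity
    have hy0 : 0 ≤ y := by positivity
    rw [hNt'] at hNt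
    -- Half of t N′(t) is x + y - t²⟨u, d⟩. Its sign follows from Cauchy-Schwarz, then from AM-GM
    -- with equality at x = y/2, the extremal point of the coefficient bound, and finally from x + y
    -- < 1.
    have hcs : (t ^ 2 * (u₁ * d₁ + u₂ * d₂)) ^ 2 ≤ 27 / 4 * x * y ^ 2 := by
      have h5 : (u₁ * d₁ + u₂ * d₂) ^ 2 ≤ x * (d₁ ^ 2 + d₂ ^ 2) := by
        nlinarith [sq_nonneg (u₁ * d₂ - u₂ * d₁)]
      rw [hd] at h5
      calc (t ^ 2 * (u₁ * d₁ + u₂ * d₂)) ^ 2 = (t ^ 2) ^ 2 * (u₁ * d₁ + u₂ * d₂) ^ 2 := by ring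
        _ ≤ (t ^ 2) ^ 2 * (x * (27 / 4 * Y ^ 2)) := by gcongr
        _ = 27 / 4 * x * y ^ 2 := by rw [hy]; ring
    have hamgm : 27 / 4 * x * y ^ 2 ≤ (x + y) ^ 3 := by
      have : 0 ≤ (x - y / 2) ^ 2 * (x + 4 * y) := by positivity
      linarith [show (x + y) ^ 3 - 27 / 4 * x * y ^ 2 = (x - y / 2) ^ 2 * (x + 4 * y) by ring]
    have hcube : (x + y) ^ 3 ≤ (x + y) ^ 2 :=
      pow_le_pow_of_le_one (by positivity) hNt.le (by norm_num)
    have hle : t ^ 2 * (u₁ * d₁ + u₂ * d₂) ≤ x + y :=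
      (abs_le_of_sq_le_sq' ((hcs.trans hamgm).trans hcube) (by positivity)).2
    have hprod : 0 ≤ t * (2 * u₁ * (a₁ + (1 - 2 * t) * d₁) + 2 * u₂ * (a₂ + (1 - 2 * t) * d₂) +
        2 * t * Y) := by
      have : t * (2 * u₁ * (a₁ + (1 - 2 * t) * d₁) + 2 * u₂ * (a₂ + (1 - 2 * t) * d₂) +
          2 * t * Y) = 2 * (x + y - t ^ 2 * (u₁ * d₁ + u₂ * d₂)) := by
        rw [hx, hy, hu₁, hu₂]; ring
      rw [this]
      linarith
    exact nonneg_of_mul_nonneg_right hprod ht0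
  have := hmono ⟨le_rfl, hσmem.2⟩ ⟨hσmem.2, le_rfl⟩ hσmem.2
  linarith

theorem Phi_apply (z : B 2) : (Phi : C(B 2, Cn 2)) z = shear z := rfl

theorem shear_apply_zero (z : Cn 2) :
    shear z 0 = z 0 + (3 * (Real.sqrt 3 : ℂ) / 2) * z 1 ^ 2 := rfl

theorem shear_apply_one (z : Cn 2) : shear z 1 = z 1 := rfl

theorem shear_injective : Function.Injective shear := by
  intro z w h
  have h0 := congrArg (fun v : Cn 2 => v 0) h
  have h1 := congrArg (fun v : Cn 2 => v 1) h
  simp only [shear_apply_zero, shear_apply_one] at h0 h1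
  rw [h1] at h0
  ext i
  fin_cases i
  · exact add_right_cancel h0
  · exact h1

theorem isUnivalent_Phi : IsUnivalent Phi := fun _ _ h => Subtype.ext (shear_injective h)

theorem shear_zero : shear 0 = 0 := by
  ext i
  fin_cases i <;> simp [shear]

theorem starConvex_range_Phi : StarConvex ℝ (0 : Cn 2) (range (Phi : C(B 2, Cn 2))) := by
  rw [starConvex_zero_iff]
  rintro _ ⟨⟨z, hz⟩, rfl⟩ τ hτ0 hτ1
  set d : ℂ := (3 * (Real.sqrt 3 : ℂ) / 2) * z 1 ^ 2 with hd
  -- The preimage of τ Φ(z): inverting the shear subtracts τ² d from τ z₁ + τ d.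
  set z' : Cn 2 := !₂[τ * z 0 + τ * (1 - τ) * d, τ * z 1] with hz'
  have hnd : d.re ^ 2 + d.im ^ 2 = 27 / 4 * (‖z 1‖ ^ 2) ^ 2 := by
    have h1 : d.re ^ 2 + d.im ^ 2 = ‖d‖ ^ 2 := by
      rw [← Complex.normSq_eq_norm_sq, Complex.normSq_apply]; ring
    have h2 : ‖d‖ = 3 * √3 / 2 * ‖z 1‖ ^ 2 := by
      rw [hd, norm_mul, norm_pow]
      congr 1
      rw [norm_div, norm_mul, Complex.norm_real, Real.norm_of_nonneg (Real.sqrt_nonneg _)]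
      norm_num
    rw [h1, h2]
    have h3 : √3 ^ 2 = 3 := Real.sq_sqrt (by norm_num)
    linear_combination (9 / 4 * (‖z 1‖ ^ 2) ^ 2) * h3
  have hzn : (z 0).re ^ 2 + (z 0).im ^ 2 + ‖z 1‖ ^ 2 < 1 := by
    have h1 : (z 0).re ^ 2 + (z 0).im ^ 2 = ‖z 0‖ ^ 2 := by
      rw [← Complex.normSq_eq_norm_sq, Complex.normSq_apply]; ring
    have h2 : ‖z‖ ^ 2 = ‖z 0‖ ^ 2 + ‖z 1‖ ^ 2 := by
      rw [EuclideanSpace.norm_sq_eq, Fin.sum_univ_two]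
    rw [h1, ← h2]
    exact pow_lt_one₀ (norm_nonneg _) (mem_ball_zero_iff.1 hz) two_ne_zero
  have hmem : z' ∈ B 2 := by
    have h1 : ‖z'‖ ^ 2 = (τ * (z 0).re + τ * (1 - τ) * d.re) ^ 2 +
        (τ * (z 0).im + τ * (1 - τ) * d.im) ^ 2 + τ ^ 2 * ‖z 1‖ ^ 2 := by
      rw [EuclideanSpace.norm_sq_eq, Fin.sum_univ_two]
      have h2 : z' 0 = ((τ * (z 0).re + τ * (1 - τ) * d.re : ℝ) : ℂ) +
          ((τ * (z 0).im + τ * (1 - τ) * d.im : ℝ) : ℂ) * Complex.I := by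
        have h3 : z' 0 = τ * z 0 + τ * (1 - τ) * d := rfl
        rw [h3]
        conv_lhs => rw [← Complex.re_add_im (z 0), ← Complex.re_add_im d]
        push_cast
        ring
      have h4 : z' 1 = τ * z 1 := rfl
      rw [h2, ← Complex.normSq_eq_norm_sq, Complex.normSq_add_mul_I, h4, norm_mul, mul_pow,
        Complex.norm_real, Real.norm_eq_abs, sq_abs]
    have h2 := norm_sq_radial_lt_one (sq_nonneg ‖z 1‖) hnd hzn hτ0 hτ1
    rw [← h1] at h2
    rw [mem_ball_zero_iff]
    exact (pow_lt_one_iff_of_nonneg (norm_nonneg _) two_ne_zero).1 h2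
  refine ⟨⟨z', hmem⟩, ?_⟩
  rw [Phi_apply, Phi_apply]
  ext i
  fin_cases i
  · change z' 0 + _ * z' 1 ^ 2 = (τ : ℂ) * (z 0 + _ * z 1 ^ 2)
    have h3 : z' 0 = τ * z 0 + τ * (1 - τ) * d := rfl
    have h4 : z' 1 = τ * z 1 := rfl
    rw [h3, h4, hd]
    ring
  · rfl

theorem hasFDerivAt_shear_zero : HasFDerivAt shear (ContinuousLinearMap.id ℂ (Cn 2)) 0 := by
  have hshear : shear = fun z : Cn 2 =>
      z + ((3 * (Real.sqrt 3 : ℂ) / 2) * z 1 ^ 2) • (!₂[(1 : ℂ), 0] : Cn 2) := by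
    ext z i
    fin_cases i <;> simp [shear]
  have hp : HasFDerivAt (fun z : Cn 2 => z 1) (EuclideanSpace.proj (𝕜 := ℂ) (1 : Fin 2)) 0 :=
    (EuclideanSpace.proj (𝕜 := ℂ) (1 : Fin 2)).hasFDerivAt
  rw [hshear]
  refine ((hasFDerivAt_id (0 : Cn 2)).add (((hp.pow 2).const_mul
    (3 * (Real.sqrt 3 : ℂ) / 2)).smul_const (!₂[(1 : ℂ), 0] : Cn 2))).congr_fderiv ?_
  ext1 v
  simp

theorem Phi_mem_classS : Phi ∈ classS 2 := by
  refine ⟨isUnivalent_Phi, shear_zero, ?_⟩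
  rw [HasScalarDerivAtOrigin, one_smul]
  refine hasFDerivAt_shear_zero.congr_of_eventuallyEq ?_
  filter_upwards [isOpen_ball.mem_nhds (mem_ball_self one_pos)] with z hz
  exact extend_of_mem _ hz

/-- Normalized univalent maps with starlike image embed into the chain `eᵗ f`. -/
theorem mem_classS0_of_starConvex {n : ℕ} {f : Hol n} (hf : f ∈ classS n)
    (hstar : StarConvex ℝ (0 : Cn n) (range (f : C(B n, Cn n)))) : f ∈ classS0 n := by
  obtain ⟨hinj, h0, hd⟩ := hf
  have happ : ∀ (c : ℂ) (z : B n), ((c • f : Hol n) : C(B n, Cn n)) z =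
      c • (f : C(B n, Cn n)) z := fun c z => rfl
  refine ⟨⟨hinj, h0, hd⟩, fun t => (Real.exp (t : ℝ) : ℂ) • f, ⟨⟨fun t z w h => ?_, ?_, fun t => ?_,
    fun t => ?_⟩, fun u hu => ⟨f, id, strictMono_id, ?_⟩⟩, by simp⟩
  · simp only [happ] at h
    exact hinj (smul_right_injective _ (Complex.ofReal_ne_zero.2 (Real.exp_pos _).ne') h)
  · rintro s t hst _ ⟨z, rfl⟩
    have hle : Real.exp (s - t : ℝ) ≤ 1 :=
      Real.exp_le_one_iff.2 (sub_nonpos.2 (by exact_mod_cast hst))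
    -- e^s f(z) = e^t · (e^{s-t} f(z)), and star-shapedness puts the bracket in the image of f.
    obtain ⟨w, hw⟩ := starConvex_zero_iff.1 hstar (mem_range_self z) (Real.exp_pos _).le hle
    refine ⟨w, ?_⟩
    rw [happ, happ, hw, Complex.coe_smul, Complex.coe_smul, smul_smul, ← Real.exp_add,
      add_sub_cancel]
  · rw [happ, h0, smul_zero]
  · have h1 : extend ((((Real.exp (t : ℝ) : ℂ) • f : Hol n)) : C(B n, Cn n)) =ᶠ[𝓝 0]
        (Real.exp (t : ℝ) : ℂ) • extend (f : C(B n, Cn n)) := by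
      filter_upwards [isOpen_ball.mem_nhds (mem_ball_self one_pos)] with z hz
      rw [Pi.smul_apply, extend_of_mem _ hz, extend_of_mem _ hz, happ]
    have h2 := HasFDerivAt.const_smul hd (Real.exp (t : ℝ) : ℂ)
    rw [one_smul] at h2
    exact h2.congr_of_eventuallyEq h1
  · have : (fun k => u (id k)) = fun _ => f := by
      ext1 k
      obtain ⟨t, ht⟩ := hu k
      rw [id, ← ht]
      change (Real.exp (-(t : ℝ)) : ℂ) • ((Real.exp (t : ℝ) : ℂ) • f) = f
      rw [smul_smul, ← Complex.ofReal_mul, ← Real.exp_add]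
      simp
    rw [this]
    exact tendsto_const_nhds

theorem Phi_mem_classS0 : Phi ∈ classS0 2 :=
  mem_classS0_of_starConvex Phi_mem_classS starConvex_range_Phi

theorem coeffL_Phi : coeffL Phi = ((3 * √3 / 2 : ℝ) : ℂ) := by
  have h1 : (fun w : ℂ => extend (Phi : C(B 2, Cn 2)) !₂[(0 : ℂ), w] 0) =ᶠ[𝓝 0]
      fun w : ℂ => (3 * (Real.sqrt 3 : ℂ) / 2) * w ^ 2 := by
    filter_upwards [ball_mem_nhds (0 : ℂ) one_pos] with w hw
    rw [extend_of_mem _ (vecZero_mem_ball (mem_ball_zero_iff.1 hw)), Phi_apply, shear_apply_zero]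
    simp
  have h2 : deriv (fun w : ℂ => (3 * (Real.sqrt 3 : ℂ) / 2) * w ^ 2) =
      fun w : ℂ => (3 * (Real.sqrt 3 : ℂ) / 2) * (2 * w) := by
    ext w
    simp [((hasDerivAt_pow 2 w).const_mul (3 * (Real.sqrt 3 : ℂ) / 2)).deriv]
  have h3 : deriv (fun w : ℂ => (3 * (Real.sqrt 3 : ℂ) / 2) * (2 * w)) 0 =
      (3 * (Real.sqrt 3 : ℂ) / 2) * 2 := by
    simp
  rw [coeffL, h1.iteratedDeriv_eq, iteratedDeriv_succ, iteratedDeriv_one, h2, h3]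
  push_cast
  ring

/-- The identity map of the ball. -/
noncomputable def idHol : Hol 2 := restrictBall id differentiable_id

/-- The identity is the second member of the class that shows the functional is not constant there.
-/
theorem idHol_mem_classS0 : idHol ∈ classS0 2 := by
  refine mem_classS0_of_starConvex ⟨fun _ _ h => Subtype.ext h, rfl, ?_⟩ ?_
  · rw [HasScalarDerivAtOrigin, one_smul]
    refine (hasFDerivAt_id (0 : Cn 2)).congr_of_eventuallyEq ?_
    filter_upwards [isOpen_ball.mem_nhds (mem_ball_self one_pos)] with z hz
    exact extend_of_mem _ hz
  · have : range (idHol : C(B 2, Cn 2)) = B 2 := Subtype.range_coe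
    rw [this]
    exact (convex_ball (0 : Cn 2) 1).starConvex (mem_ball_self one_pos)

theorem coeffL_idHol : coeffL idHol = 0 := by
  have h1 : (fun w : ℂ => extend (idHol : C(B 2, Cn 2)) !₂[(0 : ℂ), w] 0) =ᶠ[𝓝 0]
      fun _ : ℂ => (0 : ℂ) := by
    filter_upwards [ball_mem_nhds (0 : ℂ) one_pos] with w hw
    rw [extend_of_mem _ (vecZero_mem_ball (mem_ball_zero_iff.1 hw))]
    rfl
  rw [coeffL, h1.iteratedDeriv_eq]
  simp

theorem isBounded_range_Phi : Bornology.IsBounded (range (Phi : C(B 2, Cn 2))) := by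
  have h := ((isCompact_closedBall (0 : Cn 2) 1).image differentiable_shear.continuous).isBounded
  refine h.subset ?_
  rintro _ ⟨z, rfl⟩
  exact ⟨z, ball_subset_closedBall z.2, rfl⟩

theorem re_coeffL_le_Phi : ∀ f ∈ classS0 2, (coeffL f).re ≤ (coeffL Phi).re := fun f hf => by
  rw [coeffL_Phi, Complex.ofReal_re]
  exact (Complex.re_le_norm _).trans (norm_coeffL_le_of_mem_classS0 hf)

theorem isSupportPointFor_Phi : IsSupportPointFor coeffLCLM Phi := by
  refine ⟨Phi_mem_classS0, ⟨Phi, Phi_mem_classS0, idHol, idHol_mem_classS0, ?_⟩,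
    re_coeffL_le_Phi⟩
  rw [coeffLCLM_apply, coeffLCLM_apply, coeffL_Phi, coeffL_idHol, Complex.ofReal_ne_zero]
  positivity

end Shear

end Loewner

theorem theorem1p1 :
    Loewner.Phi ∈ Loewner.classS0 2 ∧
    Loewner.IsStarlike Loewner.Phi ∧
    (∀ f ∈ Loewner.classS0 2, (Loewner.coeffL f).re ≤ (Loewner.coeffL Loewner.Phi).re) ∧
    Bornology.IsBounded (Set.range (Loewner.Phi : C(Loewner.B 2, Loewner.Cn 2))) ∧
    (∃ L : Loewner.Hol 2 →L[ℂ] ℂ,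
      (∀ f, L f = Loewner.coeffL f) ∧ Loewner.IsSupportPointFor L Loewner.Phi) ∧
    Loewner.IsSupportPoint Loewner.Phi :=
  ⟨Loewner.Phi_mem_classS0,
    ⟨Loewner.isUnivalent_Phi, Loewner.shear_zero, Loewner.starConvex_range_Phi⟩,
    Loewner.re_coeffL_le_Phi, Loewner.isBounded_range_Phi,
    ⟨Loewner.coeffLCLM, Loewner.coeffLCLM_apply, Loewner.isSupportPointFor_Phi⟩,
    ⟨Loewner.coeffLCLM, Loewner.isSupportPointFor_Phi⟩⟩
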